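/- **A collection of random In/Out bridge graphs.** For a finite directed graph $G=(V,E)$, $E\subseteq V\times V$, let $D^+(v)$ and $D^-(v)$ be the out- and in-degree of $v$, and write $e_*$, $e^*$ for the source and the target of an edge $e$. The Pearson In/Out coefficient of $G$ is $$r_-^+(G)=\frac{1}{\sigma_-(G)\,\sigma^+(G)}\Big(\frac1{|E|}\sum_{e\in E}D^-(e_*)D^+(e^*)-\frac1{|E|^2}\sum_{e\in E}D^-(e_*)\sum_{e\in E}D^+(e^*)\Big),$$ where $\sigma_-(G)^2=\frac1{|E|}\sum_{e}D^-(e_*)^2-\big(\frac1{|E|}\sum_{e}D^-(e_*)\big)^2$ and $\sigma^+(G)^2=\frac1{|E|}\sum_{e}D^+(e^*)^2-\big(\frac1{|E|}\sum_{e}D^+(e^*)\big)^2$ with $\sigma_-(G),\sigma^+(G)\ge 0$. It is well defined if $\sigma_-(G),\sigma^+(G)>0$; otherwise set $r_-^+(G)=0$. The bridge graph $G(k,m)$ has the vertices $v,w,v_1,\dots,v_k,w_1,\dots,w_m$ and the edges $(v_i,v)$ for $i\le k$, $(v,w)$, and $(w,w_j)$ for $j\le m$. A random variable $X$ is regularly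 varying with exponent $\gamma$ if $\mathbb P(X>t)=L(t)t^{-\gamma}$ for all $t>0$, where $L$ is slowly varying, that is, eventually positive with $L(tx)/L(t)\to1$ as $t\to\infty$ for every $x>0$. Let $0<\gamma<2$. Let $X_1,X_2,\dots$ and $Y_1,Y_2,\dots$ be independent random variables with values in $\mathbb N=\{0,1,2,\dots\}$, the $X_i$ identically distributed and the $Y_i$ identically distributed, both regularly varying with exponent $\gamma$, and with comparable tails: $\mathbb P(Y_1>t)/\mathbb P(X_1>t)\to c$ as $t\to\infty$ for some $c\in(0,\infty)$ (for example, all $X_i$ and $Y_i$ i.i.d., with $c=1$). For $a>0$ put $W_i=X_i+Y_i$ and $Z_i=\lfloor X_i+aY_i\rfloor$, and let $\mathcal G_n^a$ be the disjoint union of the bridge graphs $G(W_i,Z_i)$, $1\le i\le n$. Then there are independent random variables $S_X,S_Y$, almost surely positive and (non-degenerate) $\gamma/2$-stable, and constants $b_n>0$, none of them depending on $a$, such that $$\frac1{b_n}\sum_{i=1}^nX_i^2\xrightarrow{d}S_X,\qquad \frac1{b_n}\sum_{i=1}^nY_i^2\xrightarrow{d}S_Y\qquad(n\to\infty),$$ and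 the following hold. 1. For every $a>0$, the probability that $\sigma_-(\mathcal G_n^a)>0$ and $\sigma^+(\mathcal G_n^a)>0$ tends to $1$, and $$r_-^+(\mathcal G_n^a)\xrightarrow{d}R_a:=\frac{S_X+aS_Y}{\sqrt{S_X+S_Y}\,\sqrt{S_X+a^2S_Y}}\qquad(n\to\infty).$$ 2. If $a>0$ and $a\neq1$, then $R_a$ is non-degenerate (not almost surely constant), and $\frac{2\sqrt a}{1+a}<R_a<1$ almost surely. 3. For every $\varepsilon\in(0,1)$ and each of the two values $a=\dfrac{2-\varepsilon^2\pm2\sqrt{1-\varepsilon^2}}{\varepsilon^2}$, one has $a>0$, $a\ne1$, $\frac{2\sqrt a}{1+a}=\varepsilon$, and $R_a\in(\varepsilon,1)$ almost surely. -/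

import Mathlib

open Filter Topology MeasureTheory ProbabilityTheory

noncomputable section

/-! ### Finite directed graphs and Pearson's degree-degree correlation coefficients -/

namespace DegreeCorrelation

/-- The edge set `E ⊆ V × V` of a finite directed graph; the edge `e` has source `e.1` and
target `e.2`. -/
def edges {V : Type*} [Fintype V] (G : Digraph V) : Finset (V × V) :=
  open scoped Classical in Finset.univ.filter fun e => G.Adj e.1 e.2

/-- The two types of degree: out-degree (`+`) and in-degree (`-`). -/
inductive DegreeType where
  | outDeg
  | inDeg

/-- The out-degree `D⁺(v) = |{e ∈ E : e has source v}|` and the in-degree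
`D⁻(v) = |{e ∈ E : e has target v}|`. -/
def degree {V : Type*} [Fintype V] (G : Digraph V) (α : DegreeType) (v : V) : ℕ :=
  open scoped Classical in
  match α with
  | .outDeg => ((edges G).filter fun e => e.1 = v).card
  | .inDeg => ((edges G).filter fun e => e.2 = v).card

/-- The average `|E|⁻¹ ∑_{e ∈ E} f e`. -/
def edgeMean {V : Type*} [Fintype V] (G : Digraph V) (f : V × V → ℝ) : ℝ :=
  (1 / ((edges G).card : ℝ)) * ∑ e ∈ edges G, f e

/-- `σ_α(G)`: standard deviation of the `α`-degree of the source of a uniform edge. -/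
def sigmaSource {V : Type*} [Fintype V] (G : Digraph V) (α : DegreeType) : ℝ :=
  √(edgeMean G (fun e => (degree G α e.1 : ℝ) ^ 2)
    - edgeMean G (fun e => (degree G α e.1 : ℝ)) ^ 2)

/-- `σ^β(G)`: standard deviation of the `β`-degree of the target of a uniform edge. -/
def sigmaTarget {V : Type*} [Fintype V] (G : Digraph V) (β : DegreeType) : ℝ :=
  √(edgeMean G (fun e => (degree G β e.2 : ℝ) ^ 2)
    - edgeMean G (fun e => (degree G β e.2 : ℝ)) ^ 2)

/-- Pearson's `α`-`β` correlation coefficient `r_α^β(G)`: the correlation, over a uniform edge,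
of the `α`-degree of its source and the `β`-degree of its target. It is meaningful when
`σ_α(G)` and `σ^β(G)` are both positive. -/
def pearson {V : Type*} [Fintype V] (G : Digraph V) (α β : DegreeType) : ℝ :=
  (1 / (sigmaSource G α * sigmaTarget G β)) *
    (edgeMean G (fun e => (degree G α e.1 : ℝ) * (degree G β e.2 : ℝ))
      - edgeMean G (fun e => (degree G α e.1 : ℝ)) * edgeMean G (fun e => (degree G β e.2 : ℝ)))

/-! ### Bridge graphs -/

/-- Vertices of the bridge graph: the two hubs `v = inl (inl ())` and `w = inl (inr ())`, the
vertices `vᵢ = inr (inl i)` for `i < k` and the vertices `wⱼ = inr (inr j)` for `j < m`. -/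
abbrev BridgeVertex (k m : ℕ) : Type := (Unit ⊕ Unit) ⊕ (Fin k ⊕ Fin m)

/-- The In/Out bridge graph `G(k, m)`: the edges are `(vᵢ, v)`, `(v, w)` and `(w, wⱼ)`. -/
def bridgeGraph (k m : ℕ) : Digraph (BridgeVertex k m) where
  Adj
    | .inr (.inl _), .inl (.inl _) => True
    | .inl (.inl _), .inl (.inr _) => True
    | .inl (.inr _), .inr (.inr _) => True
    | _, _ => False

/-- Disjoint union of a family of directed graphs. -/
def disjointUnion {ι : Type*} {V : ι → Type*} (G : ∀ i, Digraph (V i)) :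
    Digraph (Σ i, V i) where
  Adj x y := ∃ (i : ι) (u v : V i), (G i).Adj u v ∧ x = ⟨i, u⟩ ∧ y = ⟨i, v⟩

/-- The disjoint union of the bridge graphs `G(xᵢ + yᵢ, ⌊xᵢ + a yᵢ⌋)`, `i < n`. -/
def bridgeCollection (a : ℝ) (x y : ℕ → ℕ) (n : ℕ) :
    Digraph (Σ i : Fin n, BridgeVertex (x i + y i) ⌊(x i : ℝ) + a * (y i : ℝ)⌋₊) :=
  disjointUnion fun i : Fin n => bridgeGraph (x i + y i) ⌊(x i : ℝ) + a * (y i : ℝ)⌋₊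

/-! ### Regular variation and stable laws -/

/-- `L` is slowly varying (at infinity). -/
def IsSlowlyVarying (L : ℝ → ℝ) : Prop :=
  (∀ᶠ t in atTop, 0 < L t) ∧ ∀ x : ℝ, 0 < x → Tendsto (fun t => L (t * x) / L t) atTop (𝓝 1)

/-- The random variable `X` is regularly varying with exponent `γ`:
`ℙ(X > t) = L(t) t^{-γ}` for all `t > 0`, with `L` slowly varying. -/
def IsRegularlyVarying {Ω : Type*} [MeasurableSpace Ω] (P : Measure Ω) (X : Ω → ℝ) (γ : ℝ) :
    Prop :=
  ∃ L : ℝ → ℝ, IsSlowlyVarying L ∧ ∀ t : ℝ, 0 < t → P.real {ω | t < X ω} = L t * t ^ (-γ)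

/-- `μ` is a (non-degenerate) `α`-stable law on `ℝ`: if `S`, `S'`, `S''` have law `μ` and `S`, `S'`
are independent, then for all `s, t > 0` the sum `s S + t S'` has the law of
`(s ^ α + t ^ α) ^ (1 / α) S'' + d` for some real `d`. -/
def IsStableLaw (α : ℝ) (μ : Measure ℝ) : Prop :=
  IsProbabilityMeasure μ ∧ (∀ x : ℝ, μ ≠ Measure.dirac x) ∧
    ∀ s t : ℝ, 0 < s → 0 < t → ∃ d : ℝ,
      (μ.map fun x => s * x).conv (μ.map fun x => t * x)
        = μ.map fun x => (s ^ α + t ^ α) ^ (1 / α) * x + d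

end DegreeCorrelation

end

noncomputable section

namespace DegreeCorrelation

open scoped unitInterval

/-! ### Weak convergence -/

/-! In `G(k, m)` only the bridge has both a large source in-degree and a large target out-degree.
The edge sums are therefore explicit: `k * m` for the product, `k + m` for each first moment, `k ^ 2
+ m` and `k + m ^ 2` for the second moments, with `k + m + 1` edges. Multiplying numerator and
variances by the number of edges `N`, every centred sum has the form `∑ gᵢ - S ^ 2 / N`, with the
same `S` throughout and `S ≤ N`.

With `k = x + y` and `m = ⌊x + a y⌋`, the main terms are `x ^ 2 + d * y ^ 2` with `d = a`, `1`, `a ^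
2`. All the rest, including `S ^ 2 / N ≤ N`, is dominated by a multiple of `∑ (1 + xᵢ) (1 + yᵢ)`.
Squares have tail exponent `γ / 2`, so their sums are of order `B n ^ 2`, where `n * P(X > B n x) →
x ^ (-γ)`. By independence `(1 + X) (1 + Y)` keeps finite `q`-th moments for every `q < γ` with `q ≤
1`; taking `q > γ / 2` makes the error sum negligible (`tendstoInMeasure_errSum`).

The sums of squares are treated by Laplace transforms. Writing `1 - E exp (-s X² / B²)` as an
integral of the tail, dominated convergence under Potter's bound gives the exponent `Γ(1 - γ / 2) s
^ (γ / 2)`, with a factor `c` for `Y` (`tendsto_laplace_sum_sq`). Convergence of Laplace transforms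
yields weak convergence by transport to the unit interval, where they become moments. The limit laws
are stable, since their transforms satisfy the stability equation, and have no atoms.

Independence gives joint convergence to a product law, the errors enter by Slutsky's lemma, and the
continuous mapping theorem yields the limit of the coefficient. Its range follows from two
polynomial identities; non-degeneracy and strictness of the lower bound follow from the absence of
atoms. -/

theorem tendsto_map_of_ae_continuousAt {ι E F : Type*} [TopologicalSpace E] [MeasurableSpace E]
    [OpensMeasurableSpace E] [HasOuterApproxClosed E] [PseudoEMetricSpace F]
    [MeasurableSpace F] [BorelSpace F] {l : Filter ι} [l.IsCountablyGenerated]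
    {μs : ι → ProbabilityMeasure E} {μ : ProbabilityMeasure E} (h : Tendsto μs l (𝓝 μ))
    {g : E → F} (hg : Measurable g) (hc : ∀ᵐ x ∂(μ : Measure E), ContinuousAt g x) :
    Tendsto (fun i => (μs i).map hg.aemeasurable) l (𝓝 (μ.map hg.aemeasurable)) := by
  refine tendsto_of_forall_isClosed_limsup_le' fun C hC => ?_
  have hsub : ∀ i, ((μs i).map hg.aemeasurable : Measure F) C
      ≤ (μs i : Measure E) (closure (g ⁻¹' C)) := fun i => by
    rw [ProbabilityMeasure.toMeasure_map, Measure.map_apply hg hC.measurableSet]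
    exact measure_mono subset_closure
  calc limsup (fun i => ((μs i).map hg.aemeasurable : Measure F) C) l
      ≤ limsup (fun i => (μs i : Measure E) (closure (g ⁻¹' C))) l :=
        limsup_le_limsup (Eventually.of_forall hsub)
    _ ≤ (μ : Measure E) (closure (g ⁻¹' C)) :=
        ProbabilityMeasure.limsup_measure_closed_le_of_tendsto h isClosed_closure
    _ ≤ (μ : Measure E) (g ⁻¹' C) := by
        -- A continuity point of `g` in the closure of `g ⁻¹' C` is mapped into the closure of `C`,
        -- which is `C`.
        refine measure_mono_ae ?_
        filter_upwards [hc] with x hx hxC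
        rw [← hC.closure_eq]
        exact (mem_closure_iff_clusterPt.1 (hx.continuousWithinAt.mem_closure_image hxC)).mono
          (principal_mono.2 (Set.image_preimage_subset g C)) |> mem_closure_iff_clusterPt.2
    _ = (μ.map hg.aemeasurable : Measure F) C := by
        rw [ProbabilityMeasure.toMeasure_map, Measure.map_apply hg hC.measurableSet]

theorem tendstoInDistribution_comp_of_ae_continuousAt {ι Ω Ω' E F : Type*} [TopologicalSpace E]
    [MeasurableSpace E] [OpensMeasurableSpace E] [HasOuterApproxClosed E] [PseudoEMetricSpace F]
    [MeasurableSpace F] [BorelSpace F] {l : Filter ι} [l.IsCountablyGenerated]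
    [MeasurableSpace Ω] [MeasurableSpace Ω'] {P : Measure Ω} [IsProbabilityMeasure P]
    {Q : Measure Ω'} [IsProbabilityMeasure Q] {X : ι → Ω → E} {Z : Ω' → E}
    (h : TendstoInDistribution X l Z (fun _ => P) Q) {g : E → F} (hg : Measurable g)
    (hc : ∀ᵐ ω ∂Q, ContinuousAt g (Z ω)) (hX : ∀ i, Measurable (X i)) (hZ : Measurable Z) :
    TendstoInDistribution (fun i ω => g (X i ω)) l (fun ω => g (Z ω)) (fun _ => P) Q where
  forall_aemeasurable i := (hg.comp (hX i)).aemeasurable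
  aemeasurable_limit := (hg.comp hZ).aemeasurable
  tendsto := by
    have hc' : ∀ᵐ x ∂(Q.map Z), ContinuousAt g x := by
      rwa [ae_map_iff hZ.aemeasurable (IsGδ.setOfPred_continuousAt g).measurableSet]
    have := tendsto_map_of_ae_continuousAt h.tendsto hg hc'
    have e : ∀ (R : Measure E) (hR : IsProbabilityMeasure R) (R' : Measure F)
        (hR' : IsProbabilityMeasure R'), R' = R.map g →
        (⟨R', hR'⟩ : ProbabilityMeasure F)
          = ProbabilityMeasure.map (⟨R, hR⟩ : ProbabilityMeasure E) hg.aemeasurable :=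
      fun _ _ _ _ h => Subtype.ext h
    rw [← e _ _ _ (Measure.isProbabilityMeasure_map (hg.comp hZ).aemeasurable)
      (Measure.map_map hg hZ).symm] at this
    exact this.congr fun i => (e _ _ _ _ (Measure.map_map hg (hX i)).symm).symm

/-- On the unit interval, convergence of all moments implies weak convergence. -/
theorem tendsto_of_tendsto_moments {ι : Type*} {l : Filter ι} {μs : ι → ProbabilityMeasure I}
    {μ : ProbabilityMeasure I}
    (h : ∀ k : ℕ, Tendsto (fun i => ∫ x : I, (x : ℝ) ^ k ∂(μs i : Measure I)) l
      (𝓝 (∫ x : I, (x : ℝ) ^ k ∂(μ : Measure I)))) :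
    Tendsto μs l (𝓝 μ) := by
  have hpow : ∀ (ν : ProbabilityMeasure I) (k : ℕ),
      Integrable (fun x : I => (x : ℝ) ^ k) (ν : Measure I) := fun ν k =>
    Integrable.of_bound (C := 1) (by fun_prop) (Eventually.of_forall fun x => by
      rw [Real.norm_of_nonneg (pow_nonneg x.2.1 k)]
      exact pow_le_one₀ x.2.1 x.2.2)
  have hpoly : ∀ p : Polynomial ℝ, Tendsto (fun i => ∫ x : I, p.eval (x : ℝ) ∂(μs i : Measure I)) l
      (𝓝 (∫ x : I, p.eval (x : ℝ) ∂(μ : Measure I))) := by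
    intro p
    have hp : ∀ ν : ProbabilityMeasure I, ∫ x : I, p.eval (x : ℝ) ∂(ν : Measure I)
        = ∑ k ∈ Finset.range (p.natDegree + 1), p.coeff k * ∫ x : I, (x : ℝ) ^ k ∂(ν : Measure I) :=
      fun ν => by
        simp_rw [Polynomial.eval_eq_sum_range]
        rw [integral_finsetSum _ fun k _ => (hpow ν k).const_mul _]
        simp_rw [integral_const_mul]
    simp_rw [hp]
    exact tendsto_finsetSum _ fun k _ => (h k).const_mul _
  rw [ProbabilityMeasure.tendsto_iff_forall_integral_tendsto]
  intro f
  rw [Metric.tendsto_nhds]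
  intro ε hε
  -- Weierstrass approximation: one `ε / 3` for each replacement of `f` by `p`, one for the
  -- convergence of the integrals of `p`.
  obtain ⟨p, hp⟩ := exists_polynomial_near_continuousMap 0 1 f.toContinuousMap (ε / 3)
    (by positivity)
  have hpx : ∀ x : I, ‖f x - p.eval (x : ℝ)‖ ≤ ε / 3 := fun x => by
    have := (ContinuousMap.norm_coe_le_norm _ x).trans hp.le
    rw [← norm_neg]
    simpa using this
  have hint : ∀ ν : ProbabilityMeasure I, Integrable (fun x : I => p.eval (x : ℝ)) (ν : Measure I) :=
    fun ν => by
      simp_rw [Polynomial.eval_eq_sum_range]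
      exact integrable_finsetSum _ fun k _ => (hpow ν k).const_mul _
  have hd : ∀ ν : ProbabilityMeasure I,
      dist (∫ x, f x ∂(ν : Measure I)) (∫ x : I, p.eval (x : ℝ) ∂(ν : Measure I)) ≤ ε / 3 := fun ν => by
    rw [dist_eq_norm, ← integral_sub (f.integrable _) (hint ν)]
    simpa using norm_integral_le_of_norm_le_const (μ := (ν : Measure I)) (Eventually.of_forall hpx)
  filter_upwards [Metric.tendsto_nhds.1 (hpoly p) (ε / 3) (by positivity)] with i hi
  have h1 := hd (μs i)
  have h2 := hd μ
  rw [dist_comm] at h2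
  have := dist_triangle4 (∫ x, f x ∂(μs i : Measure I)) (∫ x : I, p.eval (x : ℝ) ∂(μs i : Measure I))
    (∫ x : I, p.eval (x : ℝ) ∂(μ : Measure I)) (∫ x, f x ∂(μ : Measure I))
  linarith

theorem eq_of_moments_eq {μ ν : ProbabilityMeasure I}
    (h : ∀ k : ℕ, ∫ x : I, (x : ℝ) ^ k ∂(μ : Measure I) = ∫ x : I, (x : ℝ) ^ k ∂(ν : Measure I)) :
    μ = ν :=
  tendsto_nhds_unique (f := fun _ : ℕ => μ) (l := atTop) tendsto_const_nhds
    (tendsto_of_tendsto_moments fun k => by rw [h k]; exact tendsto_const_nhds)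

/-- The probability laws on `I` form a compact space, so a limit exists along an ultrafilter. Its
moments must be the numbers `m k`, and this upgrades the convergence to the whole sequence. -/
theorem exists_tendsto_of_moments {μs : ℕ → ProbabilityMeasure I} {m : ℕ → ℝ}
    (h : ∀ k : ℕ, Tendsto (fun n => ∫ x : I, (x : ℝ) ^ k ∂(μs n : Measure I)) atTop (𝓝 (m k))) :
    ∃ μ : ProbabilityMeasure I, Tendsto μs atTop (𝓝 μ) := by
  obtain ⟨μ, -, hμ⟩ := isCompact_univ.ultrafilter_le_nhds ((hyperfilter ℕ).map μs) (by simp)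
  have hμ' : Tendsto μs (hyperfilter ℕ : Filter ℕ) (𝓝 μ) := hμ
  refine ⟨μ, tendsto_of_tendsto_moments fun k => ?_⟩
  have h1 := (ProbabilityMeasure.tendsto_iff_forall_integral_tendsto.1 hμ')
    (BoundedContinuousFunction.mkOfCompact ⟨fun x : I => (x : ℝ) ^ k, by fun_prop⟩)
  have h2 := tendsto_nhds_unique h1 ((h k).mono_left Nat.hyperfilter_le_atTop)
  have h3 : ∫ x : I, (x : ℝ) ^ k ∂(μ : Measure I) = m k := h2
  rw [h3]
  exact h k

/-! ### Laplace transforms of laws on the half-line -/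

/-- The map `x ↦ exp (-x)` from `[0, ∞)` to `[0, 1]`. -/
def expNegUnit (x : ℝ) : I := Set.projIcc 0 1 zero_le_one (Real.exp (-x))

theorem continuous_expNegUnit : Continuous expNegUnit :=
  continuous_projIcc.comp (by fun_prop)

theorem coe_expNegUnit {x : ℝ} (hx : 0 ≤ x) : (expNegUnit x : ℝ) = Real.exp (-x) := by
  rw [expNegUnit, Set.projIcc_of_mem zero_le_one
    ⟨(Real.exp_pos _).le, Real.exp_le_one_iff.2 (by linarith)⟩]

/-- The map `y ↦ -log y` from `[0, 1]` to `[0, ∞)`. -/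
def negLogUnit (y : I) : ℝ := -Real.log y

theorem measurable_negLogUnit : Measurable negLogUnit := by
  unfold negLogUnit; fun_prop

theorem negLogUnit_expNegUnit {x : ℝ} (hx : 0 ≤ x) : negLogUnit (expNegUnit x) = x := by
  rw [negLogUnit, coe_expNegUnit hx, Real.log_exp, neg_neg]

theorem map_negLogUnit_map_expNegUnit {μ : ProbabilityMeasure ℝ}
    (hμ : ∀ᵐ x ∂(μ : Measure ℝ), 0 ≤ x) :
    (μ.map continuous_expNegUnit.measurable.aemeasurable).map
      measurable_negLogUnit.aemeasurable = μ := by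
  apply Subtype.ext
  change Measure.map _ (Measure.map _ _) = _
  rw [Measure.map_map measurable_negLogUnit continuous_expNegUnit.measurable]
  have : negLogUnit ∘ expNegUnit =ᵐ[(μ : Measure ℝ)] id := by
    filter_upwards [hμ] with x hx using negLogUnit_expNegUnit hx
  rw [Measure.map_congr this, Measure.map_id]
  rfl

theorem integral_rpow_map_expNegUnit {μ : ProbabilityMeasure ℝ}
    (hμ : ∀ᵐ x ∂(μ : Measure ℝ), 0 ≤ x) (s : ℝ) :
    ∫ y : I, (y : ℝ) ^ s ∂(μ.map continuous_expNegUnit.measurable.aemeasurable : Measure I)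
      = ∫ x, Real.exp (-(s * x)) ∂(μ : Measure ℝ) := by
  rw [ProbabilityMeasure.toMeasure_map, integral_map continuous_expNegUnit.measurable.aemeasurable
    (measurable_subtype_coe.pow_const s).aestronglyMeasurable]
  refine integral_congr_ae ?_
  filter_upwards [hμ] with x hx
  rw [coe_expNegUnit hx, ← Real.exp_mul]
  ring_nf

/-- Probability laws on `[0, ∞)` are determined by their Laplace transforms. -/
theorem eq_of_laplace_eq {μ ν : ProbabilityMeasure ℝ}
    (hμ : ∀ᵐ x ∂(μ : Measure ℝ), 0 ≤ x) (hν : ∀ᵐ x ∂(ν : Measure ℝ), 0 ≤ x)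
    (h : ∀ s : ℝ, 0 < s → ∫ x, Real.exp (-(s * x)) ∂(μ : Measure ℝ)
      = ∫ x, Real.exp (-(s * x)) ∂(ν : Measure ℝ)) : μ = ν := by
  rw [← map_negLogUnit_map_expNegUnit hμ, ← map_negLogUnit_map_expNegUnit hν]
  congr 1
  refine eq_of_moments_eq fun k => ?_
  rcases k.eq_zero_or_pos with rfl | hk
  · simp [-ProbabilityMeasure.toMeasure_map]
  · simp_rw [← Real.rpow_natCast]
    rw [integral_rpow_map_expNegUnit hμ, integral_rpow_map_expNegUnit hν, h _ (by positivity)]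

/-- If the Laplace transforms of laws on `[0, ∞)` converge to a function `φ` with `φ(0+) = 1` and
`φ(∞) = 0`, then the laws converge weakly, to a law on `(0, ∞)` with Laplace transform `φ`. -/
theorem exists_tendsto_of_tendsto_laplace {μs : ℕ → ProbabilityMeasure ℝ}
    (hμs : ∀ n, ∀ᵐ x ∂(μs n : Measure ℝ), 0 ≤ x) {φ : ℝ → ℝ}
    (h : ∀ s : ℝ, 0 < s →
      Tendsto (fun n => ∫ x, Real.exp (-(s * x)) ∂(μs n : Measure ℝ)) atTop (𝓝 (φ s)))
    (h0 : Tendsto φ (𝓝[>] 0) (𝓝 1)) (hinf : Tendsto φ atTop (𝓝 0)) :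
    ∃ μ : ProbabilityMeasure ℝ, (∀ᵐ x ∂(μ : Measure ℝ), 0 < x) ∧
      (∀ s : ℝ, 0 < s → ∫ x, Real.exp (-(s * x)) ∂(μ : Measure ℝ) = φ s) ∧
      Tendsto μs atTop (𝓝 μ) := by
  obtain ⟨ν, hν⟩ := exists_tendsto_of_moments
    (μs := fun n => (μs n).map continuous_expNegUnit.measurable.aemeasurable)
    -- The zeroth moment is `1`, while the value `φ 0` is not controlled by the hypotheses.
    (m := fun k => if k = 0 then 1 else φ k) (by
      intro k
      rcases k.eq_zero_or_pos with rfl | hk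
      · simp [-ProbabilityMeasure.toMeasure_map]
      · simp_rw [← Real.rpow_natCast, integral_rpow_map_expNegUnit (hμs _), if_neg hk.ne']
        exact h k (by positivity))
  have hrpow : ∀ s : ℝ, 0 < s → ∫ y : I, (y : ℝ) ^ s ∂(ν : Measure I) = φ s := by
    intro s hs
    have h1 := (ProbabilityMeasure.tendsto_iff_forall_integral_tendsto.1 hν)
      (BoundedContinuousFunction.mkOfCompact
        ⟨fun x : I => (x : ℝ) ^ s, continuous_subtype_val.rpow_const fun _ => Or.inr hs.le⟩)
    have h2 : Tendsto (fun n => ∫ y : I, (y : ℝ) ^ s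
        ∂((μs n).map continuous_expNegUnit.measurable.aemeasurable : Measure I)) atTop
        (𝓝 (∫ y : I, (y : ℝ) ^ s ∂(ν : Measure I))) := h1
    simp_rw [integral_rpow_map_expNegUnit (hμs _)] at h2
    exact tendsto_nhds_unique h2 (h s hs)
  have hint : ∀ s : ℝ, 0 < s → Integrable (fun y : I => (y : ℝ) ^ s) (ν : Measure I) := fun s hs =>
    Integrable.of_bound (C := 1)
      (continuous_subtype_val.rpow_const fun _ => Or.inr hs.le).aestronglyMeasurable
      (Eventually.of_forall fun x => by
        rw [Real.norm_of_nonneg (Real.rpow_nonneg x.2.1 s)]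
        exact Real.rpow_le_one x.2.1 x.2.2 hs.le)
  have hind : ∀ y : I, (ν : Measure I).real {y} = ∫ x, Set.indicator {y} (fun _ => (1 : ℝ)) x ∂(ν : Measure I) :=
    fun y => by rw [integral_indicator_const _ (measurableSet_singleton _)]; simp
  have hindi : ∀ y : I, Integrable (Set.indicator {y} (fun _ => (1 : ℝ))) (ν : Measure I) :=
    fun y => (integrable_const _).indicator (measurableSet_singleton _)
  -- The point `0` of `I` stands for mass escaping to infinity. The integrand `y ^ s` vanishes
  -- there, so `φ(0+) = 1` leaves no mass.
  have hν0 : (ν : Measure I) {0} = 0 := by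
    have hle : ∀ s : ℝ, 0 < s → φ s ≤ 1 - (ν : Measure I).real {0} := by
      intro s hs
      rw [← hrpow s hs, hind]
      have h1 : (1 : ℝ) = ∫ x : I, (1 : ℝ) ∂(ν : Measure I) := by simp
      nth_rw 1 [h1]
      rw [← integral_sub (integrable_const _) (hindi _)]
      refine integral_mono (hint s hs) ((integrable_const _).sub (hindi _)) fun x => ?_
      by_cases hx : x = 0
      · simp [hx, hs.ne']
      · simpa [hx] using Real.rpow_le_one x.2.1 x.2.2 hs.le
    have := le_of_tendsto h0 (eventually_nhdsWithin_of_forall hle)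
    have h2 : (ν : Measure I).real {0} = 0 := le_antisymm (by linarith) measureReal_nonneg
    simpa [Measure.real, ENNReal.toReal_eq_zero_iff] using h2
  -- The point `1` stands for an atom of the limit at the origin, which would bound `φ` from below.
  have hν1 : (ν : Measure I) {1} = 0 := by
    have hle : ∀ s : ℝ, 0 < s → (ν : Measure I).real {1} ≤ φ s := by
      intro s hs
      rw [← hrpow s hs, hind]
      refine integral_mono (hindi _) (hint s hs) fun x => ?_
      by_cases hx : x = 1
      · simp [hx]
      · simpa [hx] using Real.rpow_nonneg x.2.1 s
    have := ge_of_tendsto hinf ((eventually_gt_atTop 0).mono hle)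
    have h2 : (ν : Measure I).real {1} = 0 := le_antisymm (by linarith) measureReal_nonneg
    simpa [Measure.real, ENNReal.toReal_eq_zero_iff] using h2
  have hae : ∀ᵐ y ∂(ν : Measure I), y ≠ 0 ∧ y ≠ 1 := by
    rw [ae_iff]
    refine measure_mono_null (t := {0} ∪ {1}) (fun y hy => ?_) (measure_union_null hν0 hν1)
    simp only [Set.mem_ofPred_eq, not_and_or, not_not] at hy
    exact hy
  have hpos : ∀ y : I, y ≠ 0 → (0 : ℝ) < y := fun y hy =>
    lt_of_le_of_ne y.2.1 fun h => hy (Subtype.ext h.symm)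
  refine ⟨ν.map measurable_negLogUnit.aemeasurable, ?_, ?_, ?_⟩
  · rw [ProbabilityMeasure.toMeasure_map, ae_map_iff measurable_negLogUnit.aemeasurable
      measurableSet_Ioi]
    filter_upwards [hae] with y hy
    have := Real.log_neg (hpos y hy.1) (lt_of_le_of_ne y.2.2 fun h => hy.2 (Subtype.ext h))
    unfold negLogUnit
    linarith
  · intro s hs
    rw [ProbabilityMeasure.toMeasure_map, integral_map measurable_negLogUnit.aemeasurable
      (by fun_prop), ← hrpow s hs]
    refine integral_congr_ae ?_
    filter_upwards [hae] with y hy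
    rw [Real.rpow_def_of_pos (hpos y hy.1)]
    unfold negLogUnit
    ring_nf
  · have := tendsto_map_of_ae_continuousAt hν measurable_negLogUnit (by
      filter_upwards [hae] with y hy
      exact ((Real.continuousAt_log (hpos y hy.1).ne').comp
        continuous_subtype_val.continuousAt).neg)
    simpa only [map_negLogUnit_map_expNegUnit (hμs _)] using this

/-! ### Positive stable laws -/

/-- `μ` is a law on `(0, ∞)` with Laplace transform `s ↦ exp (-C s ^ α)`. -/
structure IsPositiveStable (α C : ℝ) (μ : Measure ℝ) : Prop where
  isProbabilityMeasure : IsProbabilityMeasure μ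
  ae_pos : ∀ᵐ x ∂μ, 0 < x
  laplace : ∀ s : ℝ, 0 < s → ∫ x, Real.exp (-(s * x)) ∂μ = Real.exp (-(C * s ^ α))

theorem exists_isPositiveStable_of_tendsto_laplace {α C : ℝ} (hα : 0 < α) (hC : 0 < C)
    {μs : ℕ → ProbabilityMeasure ℝ} (hμs : ∀ n, ∀ᵐ x ∂(μs n : Measure ℝ), 0 ≤ x)
    (h : ∀ s : ℝ, 0 < s → Tendsto (fun n => ∫ x, Real.exp (-(s * x)) ∂(μs n : Measure ℝ)) atTop
      (𝓝 (Real.exp (-(C * s ^ α))))) :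
    ∃ μ : ProbabilityMeasure ℝ, IsPositiveStable α C μ ∧ Tendsto μs atTop (𝓝 μ) := by
  obtain ⟨μ, h1, h2, h3⟩ := exists_tendsto_of_tendsto_laplace hμs h (by
    have : Tendsto (fun s : ℝ => Real.exp (-(C * s ^ α))) (𝓝 0) (𝓝 (Real.exp (-(C * 0 ^ α)))) :=
      (Real.continuous_exp.comp ((continuous_const.mul
        (Real.continuous_rpow_const hα.le)).neg)).tendsto 0
    rw [Real.zero_rpow hα.ne', mul_zero, neg_zero, Real.exp_zero] at this
    exact this.mono_left nhdsWithin_le_nhds) (by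
    exact Real.tendsto_exp_neg_atTop_nhds_zero.comp
      ((tendsto_rpow_atTop hα).const_mul_atTop hC))
  exact ⟨μ, ⟨inferInstance, h1, h2⟩, h3⟩

theorem laplace_map_mul (μ : Measure ℝ) (k s : ℝ) :
    ∫ x, Real.exp (-(s * x)) ∂(μ.map fun x => k * x) = ∫ x, Real.exp (-(s * k * x)) ∂μ := by
  rw [integral_map (by fun_prop) (by fun_prop)]
  simp_rw [mul_assoc]

theorem laplace_conv (μ ν : Measure ℝ) [IsProbabilityMeasure μ] [IsProbabilityMeasure ν] (s : ℝ) :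
    ∫ x, Real.exp (-(s * x)) ∂(μ.conv ν)
      = (∫ x, Real.exp (-(s * x)) ∂μ) * ∫ x, Real.exp (-(s * x)) ∂ν := by
  rw [Measure.conv, integral_map (by fun_prop) (by fun_prop), ← integral_prod_mul]
  simp_rw [← Real.exp_add]
  ring_nf

theorem ae_nonneg_conv (μ ν : Measure ℝ) [IsProbabilityMeasure μ] [IsProbabilityMeasure ν]
    (hμ : ∀ᵐ x ∂μ, 0 ≤ x) (hν : ∀ᵐ x ∂ν, 0 ≤ x) : ∀ᵐ x ∂(μ.conv ν), 0 ≤ x := by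
  rw [Measure.conv, ae_map_iff (by fun_prop) measurableSet_Ici]
  have h1 := Measure.quasiMeasurePreserving_fst (μ := μ) (ν := ν) |>.ae hμ
  have h2 := Measure.quasiMeasurePreserving_snd (μ := μ) (ν := ν) |>.ae hν
  filter_upwards [h1, h2] with x h1 h2 using add_nonneg h1 h2

theorem ae_nonneg_map_mul {μ : Measure ℝ} (hμ : ∀ᵐ x ∂μ, 0 < x) {k : ℝ} (hk : 0 < k) :
    ∀ᵐ x ∂(μ.map fun x => k * x), 0 ≤ x := by
  rw [ae_map_iff (by fun_prop) measurableSet_Ici]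
  filter_upwards [hμ] with x hx using (mul_pos hk hx).le

/-- Both sides have Laplace exponent `C (s ^ α + t ^ α) u ^ α`. No translation is needed, so
stability holds with shift `0`. -/
theorem IsPositiveStable.conv_map_eq {α C : ℝ} (hα : 0 < α) {μ : Measure ℝ}
    (h : IsPositiveStable α C μ) {s t : ℝ} (hs : 0 < s) (ht : 0 < t) :
    (μ.map fun x => s * x).conv (μ.map fun x => t * x)
      = μ.map fun x => (s ^ α + t ^ α) ^ (1 / α) * x := by
  have := h.isProbabilityMeasure
  have hm : ∀ k : ℝ, IsProbabilityMeasure (μ.map fun x => k * x) := fun k =>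
    Measure.isProbabilityMeasure_map (by fun_prop)
  have := hm s
  have := hm t
  have := hm ((s ^ α + t ^ α) ^ (1 / α))
  have hst : 0 < s ^ α + t ^ α := by positivity
  have hk : 0 < (s ^ α + t ^ α) ^ (1 / α) := by positivity
  refine congrArg Subtype.val (eq_of_laplace_eq
    (μ := ⟨(μ.map fun x => s * x).conv (μ.map fun x => t * x), inferInstance⟩)
    (ν := ⟨μ.map fun x => (s ^ α + t ^ α) ^ (1 / α) * x, inferInstance⟩)
    (ae_nonneg_conv _ _ (ae_nonneg_map_mul h.ae_pos hs) (ae_nonneg_map_mul h.ae_pos ht))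
    (ae_nonneg_map_mul h.ae_pos hk) fun u hu => ?_)
  change ∫ x, Real.exp (-(u * x)) ∂((μ.map fun x => s * x).conv (μ.map fun x => t * x))
    = ∫ x, Real.exp (-(u * x)) ∂(μ.map fun x => (s ^ α + t ^ α) ^ (1 / α) * x)
  rw [laplace_conv, laplace_map_mul, laplace_map_mul, laplace_map_mul, h.laplace _ (by positivity),
    h.laplace _ (by positivity), h.laplace _ (by positivity), ← Real.exp_add,
    Real.mul_rpow hu.le hs.le, Real.mul_rpow hu.le ht.le, Real.mul_rpow hu.le hk.le,
    ← Real.rpow_mul hst.le, one_div, inv_mul_cancel₀ hα.ne', Real.rpow_one]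
  ring_nf

/-- The support of a positive stable law reaches down to `0`. -/
theorem IsPositiveStable.not_ae_ge {α C : ℝ} (hα1 : α < 1) {μ : Measure ℝ}
    (h : IsPositiveStable α C μ) {δ : ℝ} (hδ : 0 < δ) : ¬ ∀ᵐ x ∂μ, δ ≤ x := by
  intro hx
  have := h.isProbabilityMeasure
  -- A law carried by `[δ, ∞)` has transform at most `exp (-s δ)`, which decays faster than `exp (-C
  -- s ^ α)` when `α < 1`.
  have hle : ∀ s : ℝ, 0 < s → s ^ (1 - α) ≤ C / δ := by
    intro s hs
    have h1 : ∫ x, Real.exp (-(s * x)) ∂μ ≤ ∫ _, Real.exp (-(s * δ)) ∂μ := by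
      refine integral_mono_of_nonneg (Eventually.of_forall fun x => (Real.exp_pos _).le)
        (integrable_const _) ?_
      filter_upwards [hx] with x hx
      exact Real.exp_le_exp.2 (by nlinarith)
    rw [h.laplace s hs] at h1
    simp only [integral_const, probReal_univ, smul_eq_mul, one_mul, Real.exp_le_exp] at h1
    rw [Real.rpow_sub hs, Real.rpow_one, div_le_div_iff₀ (by positivity) hδ]
    linarith
  obtain ⟨s, hs1, hs2⟩ := (((tendsto_rpow_atTop (sub_pos.2 hα1)).eventually_gt_atTop (C / δ)).and
    (eventually_gt_atTop 0)).exists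
  exact absurd (hle s hs2) (not_le.2 hs1)

/-- Let `y` be a heaviest atom and `k = 2 ^ (1 / α)`. By stability `k y` is an atom of `μ ∗ μ` of
the same mass, which is the `μ`-average of `μ {k y - z}`. Maximality forces equality for almost
every `z`, so `μ` lives on finitely many positive points. Its smallest point contradicts
`not_ae_ge`. -/
theorem IsPositiveStable.measure_singleton {α C : ℝ} (hα : 0 < α) (hα1 : α < 1)
    {μ : Measure ℝ} (h : IsPositiveStable α C μ) (x : ℝ) : μ {x} = 0 := by
  have := h.isProbabilityMeasure
  by_contra hx
  have hfin : ∀ m : ENNReal, m ≠ 0 → {y : ℝ | m ≤ μ {y}}.Finite := fun m hm =>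
    Measure.finite_const_le_meas_of_disjoint_iUnion μ (pos_iff_ne_zero.2 hm)
      (fun y => measurableSet_singleton y)
      (fun a b hab => Set.disjoint_singleton.2 hab) (measure_ne_top _ _)
  obtain ⟨y, hy, hmax⟩ := Set.exists_max_image {y : ℝ | μ {x} ≤ μ {y}} (fun y => μ {y})
    (hfin _ hx) ⟨x, le_refl (μ {x})⟩
  have hy0 : μ {y} ≠ 0 := fun h0 => hx (le_antisymm (h0 ▸ hy) bot_le)
  have hmax' : ∀ z, μ {z} ≤ μ {y} := fun z => by
    by_cases hz : μ {x} ≤ μ {z}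
    · exact hmax z hz
    · exact (not_le.1 hz).le.trans hy
  have hconv := h.conv_map_eq hα one_pos one_pos
  simp only [one_mul, Measure.map_id', Real.one_rpow] at hconv
  set k : ℝ := (1 + 1) ^ (1 / α) with hk
  have hk0 : 0 < k := by positivity
  have hatom : (μ.conv μ) {k * y} = μ {y} := by
    rw [hconv, Measure.map_apply (by fun_prop) (measurableSet_singleton _)]
    congr 1
    ext z
    simp [hk0.ne']
  have hlint : (μ.conv μ) {k * y} = ∫⁻ z, μ {k * y - z} ∂μ := by
    rw [Measure.conv, Measure.map_apply (by fun_prop) (measurableSet_singleton _),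
      Measure.prod_apply (measurableSet_singleton _ |>.preimage (by fun_prop))]
    refine lintegral_congr fun z => congrArg μ ?_
    ext w
    simp only [Set.mem_preimage, Set.mem_singleton_iff]
    constructor <;> intro h <;> linarith
  have hae : ∀ᵐ z ∂μ, μ {k * y - z} = μ {y} := by
    have hle : ∫⁻ _, μ {y} ∂μ ≤ ∫⁻ z, μ {k * y - z} ∂μ := by
      rw [← hlint, hatom]; simp
    exact ae_eq_of_ae_le_of_lintegral_le (Eventually.of_forall fun z => hmax' _)
      (by rw [← hlint]; exact measure_ne_top _ _) aemeasurable_const hle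
  have hF : {z : ℝ | 0 < z ∧ μ {y} ≤ μ {k * y - z}}.Finite :=
    ((hfin _ hy0).preimage (f := fun z => k * y - z)
      (fun a _ b _ hab => by simpa using hab)).subset fun z hz => hz.2
  have hmem : ∀ᵐ z ∂μ, z ∈ {z : ℝ | 0 < z ∧ μ {y} ≤ μ {k * y - z}} := by
    filter_upwards [hae, h.ae_pos] with z h1 h2 using ⟨h2, h1.ge⟩
  obtain ⟨z₀, hz₀⟩ := hmem.exists
  obtain ⟨δ, hδ, hmin⟩ := Set.exists_min_image _ id hF ⟨z₀, hz₀⟩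
  exact h.not_ae_ge hα1 hδ.1 (hmem.mono fun z hz => hmin z hz)

theorem IsPositiveStable.isStableLaw {α C : ℝ} (hα : 0 < α) (hα1 : α < 1)
    {μ : Measure ℝ} (h : IsPositiveStable α C μ) : IsStableLaw α μ := by
  refine ⟨h.isProbabilityMeasure, fun x hx => ?_, fun s t hs ht => ⟨0, ?_⟩⟩
  · have := h.measure_singleton hα hα1 x
    simp [hx] at this
  · simpa using h.conv_map_eq hα hs ht

/-! ### Regularly varying tails -/

/-- `F` is a positive nonincreasing function, at most one, and regularly varying with exponent
`-γ`. -/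
structure IsRegularTail (γ : ℝ) (F : ℝ → ℝ) : Prop where
  antitone : Antitone F
  pos : ∀ t, 0 < F t
  le_one : ∀ t, F t ≤ 1
  tendsto_ratio : ∀ x : ℝ, 0 < x → Tendsto (fun t => F (t * x) / F t) atTop (𝓝 (x ^ (-γ)))

theorem IsRegularlyVarying.isRegularTail {Ω : Type*} [MeasurableSpace Ω] {P : Measure Ω}
    [IsProbabilityMeasure P] {X : Ω → ℝ} {γ : ℝ} (h : IsRegularlyVarying P X γ) :
    IsRegularTail γ (fun t => P.real {ω | t < X ω}) := by
  obtain ⟨L, ⟨hLpos, hL⟩, hF⟩ := h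
  have hanti : Antitone (fun t => P.real {ω | t < X ω}) := fun s t hst =>
    measureReal_mono fun ω (hω : t < X ω) => lt_of_le_of_lt hst hω
  refine ⟨hanti, fun t => ?_, fun t => measureReal_le_one, fun x hx => ?_⟩
  · obtain ⟨s, h1, h2, h3⟩ := (hLpos.and ((eventually_gt_atTop 0).and (eventually_ge_atTop t))).exists
    refine lt_of_lt_of_le ?_ (hanti h3)
    change 0 < P.real {ω | s < X ω}
    rw [hF s h2]
    positivity
  · have := (hL x hx).mul_const (x ^ (-γ))
    rw [one_mul] at this
    refine this.congr' ?_
    filter_upwards [hLpos, eventually_gt_atTop 0] with t h1 h2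
    rw [hF t h2, hF (t * x) (by positivity), Real.mul_rpow h2.le hx.le]
    have : 0 < t ^ (-γ) := by positivity
    field_simp

namespace IsRegularTail

variable {γ : ℝ} {F : ℝ → ℝ}

theorem tendsto_ratio_mul (h : IsRegularTail γ F) {x y : ℝ} (hx : 0 < x) (hy : 0 < y) :
    Tendsto (fun t => F (t * x) / F (t * y)) atTop (𝓝 ((x / y) ^ (-γ))) := by
  refine ((h.tendsto_ratio (x / y) (by positivity)).comp
    (tendsto_id.atTop_mul_const hy)).congr fun t => ?_
  simp only [Function.comp, id]
  rw [mul_assoc, mul_div_cancel₀ _ hy.ne']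

theorem tendsto_zero (h : IsRegularTail γ F) (hγ : 0 < γ) : Tendsto F atTop (𝓝 0) := by
  have hbdd : BddBelow (Set.range F) := ⟨0, by rintro _ ⟨t, rfl⟩; exact (h.pos t).le⟩
  have hl := tendsto_atTop_ciInf h.antitone hbdd
  have h0 : 0 ≤ ⨅ t, F t := le_ciInf fun t => (h.pos t).le
  rcases h0.eq_or_lt with h0 | h0
  · rwa [← h0] at hl
  · have h1 := (hl.comp (tendsto_id.atTop_mul_const (two_pos))).div hl h0.ne'
    rw [div_self h0.ne'] at h1
    have h2 := tendsto_nhds_unique h1 (h.tendsto_ratio 2 two_pos)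
    have h3 : (2 : ℝ) ^ (-γ) < 1 := Real.rpow_lt_one_of_one_lt_of_neg one_lt_two (by linarith)
    linarith

/-- Potter's bound: `F t * t ^ p` is almost nondecreasing for `p > γ`. -/
theorem exists_potter (h : IsRegularTail γ F) (hγ : 0 < γ) {p : ℝ} (hp : γ < p) :
    ∃ C t₀ : ℝ, 0 < C ∧ 0 < t₀ ∧
      ∀ t s : ℝ, 0 < t → t ≤ s → t₀ ≤ s → F t * t ^ p ≤ C * (F s * s ^ p) := by
  have hp0 : 0 < p := hγ.trans hp
  have hlt : (2 : ℝ) ^ (-p) < 2 ^ (-γ) := Real.rpow_lt_rpow_of_exponent_lt one_lt_two (by linarith)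
  obtain ⟨t₁, ht₁⟩ := eventually_atTop.1 ((h.tendsto_ratio 2 two_pos).eventually_const_lt hlt)
  set t₀ := max t₁ 1 with ht₀
  have ht₀0 : 0 < t₀ := lt_of_lt_of_le one_pos (le_max_right _ _)
  have hdouble : ∀ t, t₀ ≤ t → F t ≤ 2 ^ p * F (2 * t) := by
    intro t ht
    have := (ht₁ t ((le_max_left _ _).trans ht)).le
    rw [le_div_iff₀ (h.pos t), Real.rpow_neg two_pos.le, mul_comm t] at this
    rwa [inv_mul_le_iff₀ (by positivity)] at this
  -- Doubling `t` does not decrease `F t * t ^ p`, so the induction loses nothing; the factor `2 ^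
  -- p` is paid only once, when `s` is within a factor `2` of `t`.
  have hind : ∀ k : ℕ, ∀ t s : ℝ, t₀ ≤ t → t ≤ s → s ≤ 2 ^ (k + 1) * t →
      F t * t ^ p ≤ 2 ^ p * (F s * s ^ p) := by
    intro k
    induction k with
    | zero =>
      intro t s ht hts hs
      have h0 : 0 < t := ht₀0.trans_le ht
      rw [← mul_assoc]
      refine mul_le_mul ((hdouble t ht).trans ?_) (Real.rpow_le_rpow h0.le hts hp0.le)
        (by positivity) (by have := h.pos s; positivity)
      gcongr
      exact h.antitone (by simpa using hs)
    | succ k ih =>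
      intro t s ht hts hs
      have h0 : 0 < t := ht₀0.trans_le ht
      rcases le_total s (2 * t) with hs2 | hs2
      · rw [← mul_assoc]
        refine mul_le_mul ((hdouble t ht).trans ?_) (Real.rpow_le_rpow h0.le hts hp0.le)
          (by positivity) (by have := h.pos s; positivity)
        gcongr
        exact h.antitone hs2
      · calc F t * t ^ p ≤ 2 ^ p * F (2 * t) * t ^ p := by gcongr; exact hdouble t ht
          _ = F (2 * t) * (2 * t) ^ p := by rw [Real.mul_rpow two_pos.le h0.le]; ring
          _ ≤ 2 ^ p * (F s * s ^ p) :=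
            ih (2 * t) s (by linarith) hs2 (by rw [pow_succ] at hs; linarith)
  have hlarge : ∀ t s : ℝ, t₀ ≤ t → t ≤ s → F t * t ^ p ≤ 2 ^ p * (F s * s ^ p) := by
    intro t s ht hts
    have h0 : 0 < t := ht₀0.trans_le ht
    obtain ⟨k, hk⟩ := pow_unbounded_of_one_lt (s / t) one_lt_two
    refine hind k t s ht hts ?_
    rw [div_lt_iff₀ h0] at hk
    rw [pow_succ]
    linarith
  -- Below `t₀` regular variation says nothing; there `F ≤ 1` permits a comparison through `t₀`, at
  -- the cost of a factor `1 / F t₀`.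
  have hF1 : 1 ≤ 1 / F t₀ := by rw [le_div_iff₀ (h.pos _)]; simpa using h.le_one t₀
  refine ⟨2 ^ p / F t₀, t₀, div_pos (by positivity) (h.pos _), ht₀0, fun t s ht hts hs => ?_⟩
  have hs0 : 0 ≤ F s * s ^ p :=
    mul_nonneg (h.pos s).le (Real.rpow_nonneg (ht.le.trans hts) _)
  rcases le_total t₀ t with htt | htt
  · calc F t * t ^ p ≤ 2 ^ p * (F s * s ^ p) * 1 := by rw [mul_one]; exact hlarge t s htt hts
      _ ≤ 2 ^ p * (F s * s ^ p) * (1 / F t₀) := by gcongr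
      _ = 2 ^ p / F t₀ * (F s * s ^ p) := by ring
  · calc F t * t ^ p ≤ 1 * t₀ ^ p := by gcongr; exact h.le_one t
      _ = (F t₀ * t₀ ^ p) * (1 / F t₀) := by have := (h.pos t₀).ne'; field_simp
      _ ≤ 2 ^ p * (F s * s ^ p) * (1 / F t₀) := by
        exact mul_le_mul_of_nonneg_right (hlarge t₀ s le_rfl hs) (zero_le_one.trans hF1)
      _ = 2 ^ p / F t₀ * (F s * s ^ p) := by ring

/-- The companion of Potter's bound for exponents below `γ`: eventually `F t * t ^ q` does not
increase when `t` doubles. It supplies the finite moments of order less than `γ`. -/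
theorem exists_le_rpow (h : IsRegularTail γ F) {q : ℝ} (hq0 : 0 < q) (hq : q < γ) :
    ∃ C : ℝ, 0 < C ∧ ∀ t : ℝ, 0 < t → F t ≤ C * t ^ (-q) := by
  have hlt : (2 : ℝ) ^ (-γ) < 2 ^ (-q) := Real.rpow_lt_rpow_of_exponent_lt one_lt_two (by linarith)
  obtain ⟨t₁, ht₁⟩ := eventually_atTop.1 ((h.tendsto_ratio 2 two_pos).eventually_lt_const hlt)
  set t₀ := max t₁ 1 with ht₀
  have ht₀0 : 0 < t₀ := lt_of_lt_of_le one_pos (le_max_right _ _)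
  have hdouble : ∀ t, t₀ ≤ t → F (2 * t) * 2 ^ q ≤ F t := by
    intro t ht
    have := (ht₁ t ((le_max_left _ _).trans ht)).le
    rw [div_le_iff₀ (h.pos t), Real.rpow_neg two_pos.le, mul_comm t] at this
    rwa [le_inv_mul_iff₀ (by positivity), mul_comm] at this
  have hind : ∀ k : ℕ, ∀ t : ℝ, 0 < t → t ≤ 2 ^ (k + 1) * t₀ → F t * t ^ q ≤ (2 * t₀) ^ q := by
    intro k
    induction k with
    | zero =>
      intro t h0 ht
      calc F t * t ^ q ≤ 1 * (2 * t₀) ^ q := by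
            gcongr
            · exact h.le_one t
            · simpa using ht
        _ = _ := one_mul _
    | succ k ih =>
      intro t h0 ht
      rcases le_total t (2 * t₀) with ht2 | ht2
      · calc F t * t ^ q ≤ 1 * (2 * t₀) ^ q := by
              gcongr
              exact h.le_one t
          _ = _ := one_mul _
      · calc F t * t ^ q = F (2 * (t / 2)) * 2 ^ q * (t / 2) ^ q := by
              rw [mul_assoc, ← Real.mul_rpow two_pos.le (by positivity), mul_div_cancel₀ _ two_ne_zero]
          _ ≤ F (t / 2) * (t / 2) ^ q := by
              gcongr
              exact hdouble _ (by linarith)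
          _ ≤ _ := ih (t / 2) (by positivity) (by rw [pow_succ] at ht; linarith)
  refine ⟨(2 * t₀) ^ q, by positivity, fun t ht => ?_⟩
  obtain ⟨k, hk⟩ := pow_unbounded_of_one_lt (t / t₀) one_lt_two
  have := hind k t ht (by rw [div_lt_iff₀ ht₀0] at hk; rw [pow_succ]; nlinarith)
  rwa [Real.rpow_neg ht.le, ← div_eq_mul_inv, le_div_iff₀ (by positivity)]

/-- The normalizing sequence: `n * F (B n * x) → x ^ (-γ)`. -/
theorem exists_normalizing (h : IsRegularTail γ F) (hγ : 0 < γ) :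
    ∃ B : ℕ → ℝ, (∀ n, 0 < B n) ∧ Tendsto B atTop atTop ∧
      ∀ x : ℝ, 0 < x → Tendsto (fun n : ℕ => n * F (B n * x)) atTop (𝓝 (x ^ (-γ))) := by
  set S : ℕ → Set ℝ := fun n => {t | 0 ≤ t ∧ n * F t ≤ 1} with hS
  have hne : ∀ n, (S n).Nonempty := by
    intro n
    have h1 : Tendsto (fun t => n * F t) atTop (𝓝 ((n : ℝ) * 0)) :=
      (h.tendsto_zero hγ).const_mul _
    rw [mul_zero] at h1
    obtain ⟨t, h2, h3⟩ := ((h1.eventually_le_const one_pos).and (eventually_ge_atTop 0)).exists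
    exact ⟨t, h3, h2⟩
  have hbdd : ∀ n, BddBelow (S n) := fun n => ⟨0, fun t ht => ht.1⟩
  have hlarge : ∀ M : ℝ, 0 ≤ M → ∀ᶠ n : ℕ in atTop, M ≤ sInf (S n) := by
    intro M hM
    have h1 : Tendsto (fun n : ℕ => n * F M) atTop atTop :=
      tendsto_natCast_atTop_atTop.atTop_mul_const (h.pos M)
    filter_upwards [h1.eventually_gt_atTop 1] with n hn
    refine le_csInf (hne n) fun t ht => ?_
    by_contra hlt
    have := h.antitone (not_le.1 hlt).le
    have h3 : n * F M ≤ n * F t := by gcongr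
    linarith [ht.2]
  -- A generalized quantile. The maximum with `1` only serves to keep `B n` positive for small `n`.
  set B : ℕ → ℝ := fun n => max 1 (sInf (S n)) with hB
  have hBpos : ∀ n, 0 < B n := fun n => lt_of_lt_of_le one_pos (le_max_left _ _)
  have hBtop : Tendsto B atTop atTop := by
    refine tendsto_atTop.2 fun M => ?_
    filter_upwards [hlarge (max M 0) (le_max_right _ _)] with n hn
    exact (le_max_left _ _).trans (hn.trans (le_max_right _ _))
  -- `F` may jump at `B n`, so `n * F (B n)` is never evaluated directly. It is compared with the
  -- values at `B n * (1 ± δ)`, and regular variation makes the gap vanish as `δ → 0`.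
  have hupper : ∀ n, ∀ δ : ℝ, 0 < δ → n * F (B n * (1 + δ)) ≤ 1 := by
    intro n δ hδ
    obtain ⟨t, ht, htlt⟩ := exists_lt_of_csInf_lt (hne n)
      (show sInf (S n) < B n * (1 + δ) by
        have : sInf (S n) ≤ B n := le_max_right _ _
        nlinarith [hBpos n])
    have h2 : n * F (B n * (1 + δ)) ≤ n * F t := by
      gcongr
      exact h.antitone htlt.le
    exact h2.trans ht.2
  have hlower : ∀ᶠ n : ℕ in atTop, ∀ δ : ℝ, 0 < δ → δ < 1 → 1 < n * F (B n * (1 - δ)) := by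
    filter_upwards [hlarge 1 zero_le_one] with n hn δ hδ hδ1
    have hBn : B n = sInf (S n) := max_eq_right hn
    by_contra hcon
    have hmem : B n * (1 - δ) ∈ S n :=
      ⟨mul_nonneg (hBpos n).le (by linarith), not_lt.1 hcon⟩
    have := csInf_le (hbdd n) hmem
    rw [← hBn] at this
    nlinarith [hBpos n]
  refine ⟨B, hBpos, hBtop, fun x hx => ?_⟩
  have hcont : ContinuousAt (fun y : ℝ => (x / y) ^ (-γ)) 1 :=
    (continuousAt_const.div continuousAt_id one_ne_zero).rpow_const (Or.inl (by simpa using hx.ne'))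
  have hcont' : Tendsto (fun y : ℝ => (x / y) ^ (-γ)) (𝓝 1) (𝓝 (x ^ (-γ))) := by
    simpa [ContinuousAt] using hcont
  have hplus : Tendsto (fun δ : ℝ => 1 + δ) (𝓝[>] 0) (𝓝 1) := by
    have : Tendsto (fun δ : ℝ => 1 + δ) (𝓝 0) (𝓝 (1 + 0)) := (by fun_prop : Continuous _).tendsto 0
    rw [add_zero] at this
    exact this.mono_left nhdsWithin_le_nhds
  have hminus : Tendsto (fun δ : ℝ => 1 - δ) (𝓝[>] 0) (𝓝 1) := by
    have : Tendsto (fun δ : ℝ => 1 - δ) (𝓝 0) (𝓝 (1 - 0)) := (by fun_prop : Continuous _).tendsto 0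
    rw [sub_zero] at this
    exact this.mono_left nhdsWithin_le_nhds
  have hsmall : ∀ᶠ δ : ℝ in 𝓝[>] 0, 0 < δ ∧ δ < 1 := by
    filter_upwards [Ioo_mem_nhdsGT (zero_lt_one (α := ℝ))] with δ hδ using hδ
  refine tendsto_order.2 ⟨fun r hr => ?_, fun r hr => ?_⟩
  · obtain ⟨δ, h1, h2, h3⟩ :=
      (((hcont'.comp hminus).eventually_const_lt hr).and hsmall).exists
    have h4 := ((h.tendsto_ratio_mul hx (sub_pos.2 h3)).comp hBtop).eventually_const_lt h1
    filter_upwards [h4, hlower] with n h5 h6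
    refine lt_of_lt_of_le h5 ?_
    simp only [Function.comp]
    rw [div_le_iff₀ (h.pos _)]
    nlinarith [h6 δ h2 h3, h.pos (B n * x)]
  · obtain ⟨δ, h1, h2, h3⟩ :=
      (((hcont'.comp hplus).eventually_lt_const hr).and hsmall).exists
    have h4 := ((h.tendsto_ratio_mul hx (by linarith : 0 < 1 + δ)).comp hBtop).eventually_lt_const h1
    filter_upwards [h4] with n h5
    refine lt_of_le_of_lt ?_ h5
    simp only [Function.comp]
    rw [le_div_iff₀ (h.pos _)]
    nlinarith [hupper n δ h2, h.pos (B n * x)]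

/-- The normalizing sequence grows faster than `n ^ (1 / r)` for `r > γ`. -/
theorem tendsto_div_rpow (h : IsRegularTail γ F) (hγ : 0 < γ) {B : ℕ → ℝ}
    (hBtop : Tendsto B atTop atTop) {K : ℝ} (hB : ∀ᶠ n : ℕ in atTop, n * F (B n) ≤ K) {r : ℝ}
    (hr : γ < r) : Tendsto (fun n : ℕ => n / B n ^ r) atTop (𝓝 0) := by
  -- Potter's bound between the fixed `t₀` and `B n` gives `n = O(B n ^ p)`; the spare exponent `r -
  -- p` then forces the limit `0`.
  obtain ⟨p, hp1, hp2⟩ := exists_between hr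
  obtain ⟨C, t₀, hC, ht₀, hpot⟩ := h.exists_potter hγ hp1
  have hc : 0 < F t₀ * t₀ ^ p := mul_pos (h.pos _) (by positivity)
  have hlim : Tendsto (fun n : ℕ => K * C / (F t₀ * t₀ ^ p) * B n ^ (-(r - p))) atTop (𝓝 0) := by
    have := ((tendsto_rpow_neg_atTop (sub_pos.2 hp2)).comp hBtop).const_mul
      (K * C / (F t₀ * t₀ ^ p))
    rwa [mul_zero] at this
  refine squeeze_zero' ?_ ?_ hlim
  · filter_upwards [hBtop.eventually_gt_atTop 0] with n hn
    positivity
  · filter_upwards [hB, hBtop.eventually_ge_atTop t₀] with n hn hB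
    have hBn : 0 < B n := ht₀.trans_le hB
    have h1 := hpot t₀ (B n) ht₀ hB hB
    have h2 : n * (F t₀ * t₀ ^ p) ≤ K * C * B n ^ p := by
      calc n * (F t₀ * t₀ ^ p) ≤ n * (C * (F (B n) * B n ^ p)) := by gcongr
        _ = (n * F (B n)) * (C * B n ^ p) := by ring
        _ ≤ K * (C * B n ^ p) := by gcongr
        _ = _ := by ring
    rw [neg_sub, Real.rpow_sub hBn, div_le_iff₀ (by positivity)]
    have h3 : (n : ℝ) ≤ K * C * B n ^ p / (F t₀ * t₀ ^ p) := by rwa [le_div_iff₀ hc]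
    refine h3.trans (le_of_eq ?_)
    field_simp

end IsRegularTail

/-! ### Laplace transforms of sums of squares -/

/-- The layer-cake formula, as `1 - exp (-s η)` is the integral of `s exp (-s u)` over `0 < u < η`.
It expresses the Laplace transform through the tail alone. -/
theorem one_sub_laplace_eq {Ω : Type*} [MeasurableSpace Ω] {P : Measure Ω} [IsProbabilityMeasure P]
    {η : Ω → ℝ} (hη : Measurable η) (hη0 : ∀ ω, 0 ≤ η ω) {s : ℝ} (hs : 0 < s) :
    1 - ∫ ω, Real.exp (-(s * η ω)) ∂P
      = ∫ u in Set.Ioi 0, P.real {ω | u < η ω} * (s * Real.exp (-(s * u))) := by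
  have hprim : ∀ ω, ∫ u in (0 : ℝ)..η ω, s * Real.exp (-(s * u)) = 1 - Real.exp (-(s * η ω)) := by
    intro ω
    have hd : ∀ u ∈ Set.uIcc 0 (η ω), HasDerivAt (fun u => -Real.exp (-(s * u)))
        (s * Real.exp (-(s * u))) u := by
      intro u _
      have := (((hasDerivAt_id u).const_mul s).neg.exp).neg
      convert! this using 1
      simp; ring
    rw [intervalIntegral.integral_eq_sub_of_hasDerivAt hd
      (Continuous.intervalIntegrable (by fun_prop) _ _)]
    simp; ring
  have hexp : Integrable (fun ω => Real.exp (-(s * η ω))) P :=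
    Integrable.of_bound (C := 1) (by fun_prop) (Eventually.of_forall fun ω => by
      rw [Real.norm_of_nonneg (Real.exp_pos _).le, Real.exp_le_one_iff]
      nlinarith [hη0 ω])
  have hlay := lintegral_comp_eq_lintegral_meas_lt_mul P (Eventually.of_forall hη0) hη.aemeasurable
    (g := fun u => s * Real.exp (-(s * u)))
    (fun t _ => Continuous.intervalIntegrable (by fun_prop) _ _)
    (Eventually.of_forall fun u => by positivity)
  simp_rw [hprim] at hlay
  have h1 : 1 - ∫ ω, Real.exp (-(s * η ω)) ∂P = ∫ ω, (1 - Real.exp (-(s * η ω))) ∂P := by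
    rw [integral_sub (integrable_const _) hexp]; simp
  have hanti : Antitone (fun u => P.real {ω | u < η ω}) := fun a b hab =>
    measureReal_mono fun ω (hω : b < η ω) => lt_of_le_of_lt hab hω
  rw [h1, integral_eq_lintegral_of_nonneg_ae, integral_eq_lintegral_of_nonneg_ae, hlay]
  · congr 1
    refine lintegral_congr fun u => ?_
    rw [ENNReal.ofReal_mul measureReal_nonneg, ofReal_measureReal]
  · exact Eventually.of_forall fun u => by positivity
  · exact (hanti.measurable.mul (by fun_prop)).aestronglyMeasurable
  · refine Eventually.of_forall fun ω => ?_
    simp only [Pi.zero_apply, sub_nonneg, Real.exp_le_one_iff]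
    nlinarith [hη0 ω]
  · fun_prop

/-- The constant in the Laplace exponent of the limit law. -/
def laplaceConst (γ c : ℝ) : ℝ := c * Real.Gamma (1 - γ / 2)

theorem integral_rpow_mul_laplace {γ : ℝ} (hγ2 : γ < 2) (c : ℝ) {s : ℝ} (hs : 0 < s) :
    ∫ u in Set.Ioi (0 : ℝ), c * (√u) ^ (-γ) * (s * Real.exp (-(s * u)))
      = laplaceConst γ c * s ^ (γ / 2) := by
  have h1 := Real.integral_rpow_mul_exp_neg_mul_Ioi (show 0 < 1 - γ / 2 by linarith) hs
  have h2 : ∀ u ∈ Set.Ioi (0 : ℝ), c * (√u) ^ (-γ) * (s * Real.exp (-(s * u)))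
      = c * s * (u ^ (1 - γ / 2 - 1) * Real.exp (-(s * u))) := by
    intro u hu
    rw [Real.sqrt_eq_rpow, ← Real.rpow_mul (le_of_lt hu)]
    ring_nf
  rw [setIntegral_congr_fun measurableSet_Ioi h2, integral_const_mul, h1, laplaceConst, one_div,
    Real.inv_rpow hs.le, ← Real.rpow_neg hs.le, show -(1 - γ / 2) = γ / 2 - 1 by ring,
    Real.rpow_sub_one hs.ne']
  field_simp

theorem IsRegularTail.tendsto_integral_laplace {γ : ℝ} {F : ℝ → ℝ} (h : IsRegularTail γ F)
    (hγ : 0 < γ) (hγ2 : γ < 2) {B : ℕ → ℝ} (hBtop : Tendsto B atTop atTop) {c : ℝ}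
    (hB : ∀ x : ℝ, 0 < x → Tendsto (fun n : ℕ => n * F (B n * x)) atTop (𝓝 (c * x ^ (-γ))))
    {s : ℝ} (hs : 0 < s) :
    Tendsto (fun n : ℕ => n * ∫ u in Set.Ioi (0 : ℝ), F (B n * √u) * (s * Real.exp (-(s * u))))
      atTop (𝓝 (laplaceConst γ c * s ^ (γ / 2))) := by
  obtain ⟨p, hp1, hp2⟩ := exists_between hγ2
  obtain ⟨C, t₀, hC, ht₀, hpot⟩ := h.exists_potter hγ hp1
  have hK := (hB 1 one_pos).eventually_lt_const
    (show c * 1 ^ (-γ) < c + 1 by rw [Real.one_rpow]; linarith)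
  simp only [mul_one] at hK
  simp_rw [← integral_const_mul]
  rw [← integral_rpow_mul_laplace hγ2 c hs]
  -- For `u ≤ 1` Potter's bound gives the first summand, integrable at `0` because `p < 2`. For `u ≥
  -- 1` monotonicity gives `n * F (B n) ≤ c + 1`. Potter's bound is needed here with the smaller
  -- argument `B n * √u` arbitrarily close to `0`.
  refine tendsto_integral_filter_of_dominated_convergence
    (fun u => (C * (c + 1) * u ^ (-(p / 2)) + (c + 1)) * (s * Real.exp (-(s * u)))) ?_ ?_ ?_ ?_
  · exact Eventually.of_forall fun n => ((((h.antitone.measurable).comp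
      (by fun_prop : Measurable fun u => B n * √u)).mul (by fun_prop)).const_mul _).aestronglyMeasurable
  · filter_upwards [hK, hBtop.eventually_ge_atTop t₀] with n hn hBt
    have hBn : 0 < B n := ht₀.trans_le hBt
    refine (ae_restrict_iff' measurableSet_Ioi).2 (Eventually.of_forall fun u (hu : 0 < u) => ?_)
    have hFp := h.pos (B n * √u)
    have hc1 : 0 ≤ c + 1 := le_trans (by have := h.pos (B n); positivity) hn.le
    rw [Real.norm_of_nonneg (by positivity), ← mul_assoc]
    gcongr
    rcases le_total u 1 with hu1 | hu1
    · have hsq : √u ≤ 1 := Real.sqrt_le_one.2 hu1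
      have h1 := hpot (B n * √u) (B n) (by positivity) (by nlinarith) hBt
      rw [Real.mul_rpow hBn.le (Real.sqrt_nonneg u)] at h1
      have h2 : F (B n * √u) * √u ^ p ≤ C * F (B n) := by
        have : 0 < B n ^ p := by positivity
        nlinarith
      have h3 : u ^ (-(p / 2)) = (√u ^ p)⁻¹ := by
        rw [Real.sqrt_eq_rpow, ← Real.rpow_mul hu.le, ← Real.rpow_neg hu.le]
        ring_nf
      have h4 : n * F (B n * √u) ≤ C * (c + 1) * u ^ (-(p / 2)) := by
        rw [h3, ← div_eq_mul_inv, le_div_iff₀ (by positivity)]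
        calc n * F (B n * √u) * √u ^ p = n * (F (B n * √u) * √u ^ p) := by ring
          _ ≤ n * (C * F (B n)) := by gcongr
          _ = C * (n * F (B n)) := by ring
          _ ≤ C * (c + 1) := by gcongr
      linarith
    · have h1 : F (B n * √u) ≤ F (B n) :=
        h.antitone (by nlinarith [Real.one_le_sqrt.2 hu1])
      have h2 : n * F (B n * √u) ≤ n * F (B n) := by gcongr
      have h3 : 0 ≤ C * (c + 1) * u ^ (-(p / 2)) := by positivity
      linarith
  · have hint : ∀ r : ℝ, -1 < r →
        IntegrableOn (fun u : ℝ => u ^ r * Real.exp (-(s * u))) (Set.Ioi 0) := fun r hr => by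
      simpa using integrableOn_rpow_mul_exp_neg_mul_rpow hr one_pos hs
    have h1 := ((hint (-(p / 2)) (by linarith)).const_mul (C * (c + 1) * s)).add
      ((hint 0 (by norm_num)).const_mul ((c + 1) * s))
    refine h1.congr (Eventually.of_forall fun u => ?_)
    simp only [Pi.add_apply, Real.rpow_zero]
    ring
  · refine (ae_restrict_iff' measurableSet_Ioi).2 (Eventually.of_forall fun u (hu : 0 < u) => ?_)
    simp_rw [← mul_assoc]
    have := ((hB (√u) (by positivity)).mul_const s).mul_const (Real.exp (-(s * u)))
    simpa only [mul_assoc] using this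

theorem tendsto_laplace_sum_sq {Ω : Type*} [MeasurableSpace Ω] {P : Measure Ω}
    [IsProbabilityMeasure P] {ξ : ℕ → Ω → ℝ} (hmeas : ∀ i, Measurable (ξ i))
    (hnonneg : ∀ i ω, 0 ≤ ξ i ω) (hindep : iIndepFun ξ P)
    (hident : ∀ i, IdentDistrib (ξ i) (ξ 0) P P) {γ : ℝ} (hγ : 0 < γ) (hγ2 : γ < 2)
    (hF : IsRegularTail γ (fun t => P.real {ω | t < ξ 0 ω})) {B : ℕ → ℝ} (hBpos : ∀ n, 0 < B n)
    (hBtop : Tendsto B atTop atTop) {c : ℝ}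
    (hB : ∀ x : ℝ, 0 < x →
      Tendsto (fun n : ℕ => n * P.real {ω | B n * x < ξ 0 ω}) atTop (𝓝 (c * x ^ (-γ))))
    {s : ℝ} (hs : 0 < s) :
    Tendsto (fun n : ℕ => ∫ ω, Real.exp (-(s * ((∑ i ∈ Finset.range n, ξ i ω ^ 2) / B n ^ 2))) ∂P)
      atTop (𝓝 (Real.exp (-(laplaceConst γ c * s ^ (γ / 2))))) := by
  have h1 := hF.tendsto_integral_laplace hγ hγ2 hBtop hB hs
  have h2 : ∀ n : ℕ, ∫ u in Set.Ioi (0 : ℝ), P.real {ω | B n * √u < ξ 0 ω}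
      * (s * Real.exp (-(s * u))) = 1 - ∫ ω, Real.exp (-(s * (ξ 0 ω ^ 2 / B n ^ 2))) ∂P := by
    intro n
    rw [one_sub_laplace_eq (((hmeas 0).pow_const 2).div_const _) (fun ω => by positivity) hs]
    refine setIntegral_congr_fun measurableSet_Ioi fun u (hu : 0 < u) => ?_
    have : {ω | B n * √u < ξ 0 ω} = {ω | u < ξ 0 ω ^ 2 / B n ^ 2} := by
      ext ω
      have hb := hBpos n
      simp only [Set.mem_ofPred_eq]
      rw [lt_div_iff₀ (by positivity), ← Real.sq_sqrt hu.le, ← mul_pow,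
        Real.sqrt_sq (Real.sqrt_nonneg u), mul_comm (B n)]
      exact (pow_lt_pow_iff_left₀ (by positivity) (hnonneg 0 ω) two_ne_zero).symm
    simp only [this]
  simp_rw [h2] at h1
  -- The transform of the sum is an `n`-th power of `1 - λₙ` with `n λₙ` convergent.
  have h3 : Tendsto (fun n : ℕ => (1 + (∫ ω, Real.exp (-(s * (ξ 0 ω ^ 2 / B n ^ 2))) ∂P - 1)) ^ n)
      atTop (𝓝 (Real.exp (-(laplaceConst γ c * s ^ (γ / 2))))) := by
    refine Real.tendsto_one_add_pow_exp_of_tendsto (h1.neg.congr fun n => ?_)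
    ring
  refine h3.congr fun n => ?_
  have h4 : iIndepFun (fun i ω => Real.exp (-(s * (ξ i ω ^ 2 / B n ^ 2)))) P :=
    hindep.comp (fun _ x => Real.exp (-(s * (x ^ 2 / B n ^ 2)))) fun _ => by fun_prop
  have h5 : ∀ i, ∫ ω, Real.exp (-(s * (ξ i ω ^ 2 / B n ^ 2))) ∂P
      = ∫ ω, Real.exp (-(s * (ξ 0 ω ^ 2 / B n ^ 2))) ∂P := fun i =>
    ((hident i).comp (u := fun x => Real.exp (-(s * (x ^ 2 / B n ^ 2)))) (by fun_prop)).integral_eq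
  have h6 : ∀ ω, Real.exp (-(s * ((∑ i ∈ Finset.range n, ξ i ω ^ 2) / B n ^ 2)))
      = ∏ i : Fin n, Real.exp (-(s * (ξ i ω ^ 2 / B n ^ 2))) := fun ω => by
    rw [← Real.exp_sum, ← Finset.sum_range fun i => -(s * (ξ i ω ^ 2 / B n ^ 2)),
      Finset.sum_neg_distrib, ← Finset.mul_sum, Finset.sum_div]
  simp_rw [h6]
  rw [(h4.precomp Fin.val_injective).integral_fun_prod_eq_prod_integral]
  · simp [h5]
  · intro i
    have := hmeas i
    exact Measurable.aestronglyMeasurable (by fun_prop)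

/-! ### Negligible sums -/

theorem integrable_rpow_of_tail {Ω : Type*} [MeasurableSpace Ω] {P : Measure Ω}
    [IsProbabilityMeasure P] {ξ : Ω → ℝ} (hξ : Measurable ξ) (hξ0 : ∀ ω, 0 ≤ ξ ω) {γ : ℝ}
    (hF : IsRegularTail γ (fun t => P.real {ω | t < ξ ω})) {q : ℝ} (hq : 0 < q) (hqγ : q < γ) :
    Integrable (fun ω => ξ ω ^ q) P := by
  obtain ⟨r, hr1, hr2⟩ := exists_between hqγ
  obtain ⟨C, hC, hle⟩ := hF.exists_le_rpow (hq.trans hr1) hr2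
  refine ⟨(hξ.pow_const q).aestronglyMeasurable, ?_⟩
  rw [hasFiniteIntegral_iff_ofReal (Eventually.of_forall fun ω => Real.rpow_nonneg (hξ0 ω) q),
    lintegral_rpow_eq_lintegral_meas_lt_mul P (Eventually.of_forall hξ0) hξ.aemeasurable hq]
  refine ENNReal.mul_lt_top ENNReal.ofReal_lt_top ?_
  -- Near `0` the tail is at most `1` and `q > 0` suffices; beyond `1` the tail is at most `C t ^
  -- (-r)` with `r > q`.
  rw [← Set.Ioc_union_Ioi_eq_Ioi zero_le_one]
  refine (lintegral_union_le _ _ _).trans_lt (ENNReal.add_lt_top.2 ⟨?_, ?_⟩)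
  · have hint : IntegrableOn (fun t : ℝ => t ^ (q - 1)) (Set.Ioc 0 1) :=
      (intervalIntegrable_iff_integrableOn_Ioc_of_le zero_le_one).1
        (intervalIntegral.intervalIntegrable_rpow' (by linarith))
    refine lt_of_le_of_lt (lintegral_mono fun t => ?_) (Integrable.lintegral_lt_top hint)
    calc P {ω | t < ξ ω} * ENNReal.ofReal (t ^ (q - 1))
        ≤ 1 * ENNReal.ofReal (t ^ (q - 1)) := by gcongr; exact prob_le_one
      _ = _ := one_mul _
  · have hint : IntegrableOn (fun t : ℝ => C * t ^ (q - 1 - r)) (Set.Ioi 1) :=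
      (integrableOn_Ioi_rpow_of_lt (by linarith) one_pos).const_mul C
    refine lt_of_le_of_lt (setLIntegral_mono' measurableSet_Ioi fun t (ht : 1 < t) => ?_)
      (Integrable.lintegral_lt_top hint)
    have ht0 : 0 < t := one_pos.trans ht
    rw [← ofReal_measureReal, ← ENNReal.ofReal_mul measureReal_nonneg]
    refine ENNReal.ofReal_le_ofReal ?_
    have h1 := hle t ht0
    rw [show q - 1 - r = -r + (q - 1) by ring, Real.rpow_add ht0, ← mul_assoc]
    gcongr

theorem integrable_one_add_rpow {Ω : Type*} [MeasurableSpace Ω] {P : Measure Ω}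
    [IsProbabilityMeasure P] {ξ : Ω → ℝ} (hξ : Measurable ξ) (hξ0 : ∀ ω, 0 ≤ ξ ω) {q : ℝ}
    (hq : 0 < q) (hq1 : q ≤ 1) (h : Integrable (fun ω => ξ ω ^ q) P) :
    Integrable (fun ω => (1 + ξ ω) ^ q) P := by
  refine ((integrable_const 1).add h).mono'
    ((hξ.const_add 1).pow_const q).aestronglyMeasurable (Eventually.of_forall fun ω => ?_)
  have h0 := hξ0 ω
  rw [Real.norm_of_nonneg (by positivity)]
  simpa using Real.rpow_add_le_add_rpow zero_le_one h0 hq.le hq1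

theorem rpow_sum_le_sum_rpow {ι : Type*} (s : Finset ι) {f : ι → ℝ} (hf : ∀ i, 0 ≤ f i) {q : ℝ}
    (hq : 0 < q) (hq1 : q ≤ 1) : (∑ i ∈ s, f i) ^ q ≤ ∑ i ∈ s, f i ^ q := by
  classical
  induction s using Finset.induction_on with
  | empty => simp [hq.ne']
  | insert i s hi ih =>
    rw [Finset.sum_insert hi, Finset.sum_insert hi]
    exact (Real.rpow_add_le_add_rpow (hf i) (Finset.sum_nonneg fun j _ => hf j) hq.le hq1).trans
      (by gcongr)

/-- The variables need not have a first moment. As `t ↦ t ^ q` is subadditive for `q ≤ 1`, Markov's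
inequality for the `q`-th powers bounds the probability by `n M / (ε b n) ^ q`. -/
theorem tendstoInMeasure_sum_div_zero {Ω : Type*} [MeasurableSpace Ω] {P : Measure Ω}
    [IsProbabilityMeasure P] {T : ℕ → Ω → ℝ} (hT0 : ∀ i ω, 0 ≤ T i ω) {q M : ℝ} (hq : 0 < q)
    (hq1 : q ≤ 1) (hint : ∀ i, Integrable (fun ω => T i ω ^ q) P)
    (hM : ∀ i, ∫ ω, T i ω ^ q ∂P = M) {b : ℕ → ℝ} (hb : ∀ n, 0 < b n)
    (hlim : Tendsto (fun n : ℕ => n / b n ^ q) atTop (𝓝 0)) :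
    TendstoInMeasure P (fun n ω => (∑ i ∈ Finset.range n, T i ω) / b n) atTop (fun _ => (0 : ℝ)) := by
  rw [tendstoInMeasure_iff_measureReal_norm]
  intro ε hε
  have hlim' : Tendsto (fun n : ℕ => M / ε ^ q * (n / b n ^ q)) atTop (𝓝 0) := by
    simpa using hlim.const_mul (M / ε ^ q)
  refine squeeze_zero (fun n => measureReal_nonneg) (fun n => ?_) hlim'
  have hbn := hb n
  have hsub : {ω | ε ≤ ‖(∑ i ∈ Finset.range n, T i ω) / b n - 0‖}
      ⊆ {ω | (ε * b n) ^ q ≤ ∑ i ∈ Finset.range n, T i ω ^ q} := by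
    intro ω hω
    simp only [Set.mem_ofPred_eq, sub_zero] at hω ⊢
    have hs : 0 ≤ ∑ i ∈ Finset.range n, T i ω := Finset.sum_nonneg fun i _ => hT0 i ω
    rw [Real.norm_of_nonneg (by positivity), le_div_iff₀ hbn] at hω
    exact (Real.rpow_le_rpow (by positivity) hω hq.le).trans
      (rpow_sum_le_sum_rpow _ (fun i => hT0 i ω) hq hq1)
  have hmk := mul_meas_ge_le_integral_of_nonneg
    (f := fun ω => ∑ i ∈ Finset.range n, T i ω ^ q) (μ := P)
    (Eventually.of_forall fun ω => Finset.sum_nonneg fun i _ => Real.rpow_nonneg (hT0 i ω) q)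
    (integrable_finsetSum _ fun i _ => hint i) ((ε * b n) ^ q)
  rw [integral_finsetSum _ fun i _ => hint i, Finset.sum_congr rfl fun i _ => hM i,
    Finset.sum_const, Finset.card_range, nsmul_eq_mul, Real.mul_rpow hε.le hbn.le] at hmk
  have hmono := measureReal_mono hsub (μ := P)
  rw [Real.mul_rpow hε.le hbn.le] at hmono
  refine hmono.trans ?_
  have h1 : 0 < ε ^ q := by positivity
  have h2 : 0 < b n ^ q := by positivity
  rw [div_mul_div_comm, le_div_iff₀ (by positivity)]
  linarith

/-! ### Edge sums in collections of bridge graphs -/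

section Graphs

variable {M : Type*} [AddCommMonoid M]

open scoped Classical in
theorem sum_edges {V : Type*} [Fintype V] (G : Digraph V) (f : V × V → M) :
    ∑ e ∈ edges G, f e = ∑ u, ∑ v, if G.Adj u v then f (u, v) else 0 := by
  rw [edges, Finset.sum_filter, Fintype.sum_prod_type]

open scoped Classical in
theorem degree_outDeg_eq {V : Type*} [Fintype V] (G : Digraph V) (v : V) :
    degree G .outDeg v = ∑ e ∈ edges G, if e.1 = v then 1 else 0 := by
  simp only [degree, Finset.card_filter]

open scoped Classical in
theorem degree_inDeg_eq {V : Type*} [Fintype V] (G : Digraph V) (v : V) :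
    degree G .inDeg v = ∑ e ∈ edges G, if e.2 = v then 1 else 0 := by
  simp only [degree, Finset.card_filter]

section DisjointUnion

variable {ι : Type*} {V : ι → Type*} (G : ∀ i, Digraph (V i))

theorem disjointUnion_adj_same (i : ι) (u v : V i) :
    (disjointUnion G).Adj ⟨i, u⟩ ⟨i, v⟩ ↔ (G i).Adj u v := by
  constructor
  · rintro ⟨j, u', v', h, hu, hv⟩
    cases hu
    cases hv
    exact h
  · exact fun h => ⟨i, u, v, h, rfl, rfl⟩

theorem not_disjointUnion_adj {i j : ι} (hij : j ≠ i) (u : V i) (v : V j) :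
    ¬ (disjointUnion G).Adj ⟨i, u⟩ ⟨j, v⟩ := by
  rintro ⟨l, u', v', -, hu, hv⟩
  exact hij ((congrArg Sigma.fst hv).trans (congrArg Sigma.fst hu).symm)

variable [Fintype ι] [∀ i, Fintype (V i)]

theorem sum_edges_disjointUnion (f : (Σ i, V i) × (Σ i, V i) → M) :
    ∑ e ∈ edges (disjointUnion G), f e
      = ∑ i, ∑ e ∈ edges (G i), f (⟨i, e.1⟩, ⟨i, e.2⟩) := by
  classical
  rw [sum_edges, Fintype.sum_sigma]
  refine Finset.sum_congr rfl fun i _ => ?_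
  rw [sum_edges]
  refine Finset.sum_congr rfl fun u _ => ?_
  rw [Fintype.sum_sigma, Fintype.sum_eq_single i]
  · simp_rw [disjointUnion_adj_same]
  · intro j hj
    exact Finset.sum_eq_zero fun v _ => if_neg (not_disjointUnion_adj G hj u v)

theorem degree_disjointUnion (α : DegreeType) (i : ι) (v : V i) :
    degree (disjointUnion G) α ⟨i, v⟩ = degree (G i) α v := by
  classical
  cases α
  · rw [degree_outDeg_eq, degree_outDeg_eq, sum_edges_disjointUnion, Fintype.sum_eq_single i]
    · simp
    · intro j hj
      refine Finset.sum_eq_zero fun e _ => if_neg fun h => hj (congrArg Sigma.fst h)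
  · rw [degree_inDeg_eq, degree_inDeg_eq, sum_edges_disjointUnion, Fintype.sum_eq_single i]
    · simp
    · intro j hj
      refine Finset.sum_eq_zero fun e _ => if_neg fun h => hj (congrArg Sigma.fst h)

end DisjointUnion

theorem sum_edges_bridgeGraph (k m : ℕ) (f : BridgeVertex k m × BridgeVertex k m → M) :
    ∑ e ∈ edges (bridgeGraph k m), f e
      = (∑ i : Fin k, f (.inr (.inl i), .inl (.inl ()))) + f (.inl (.inl ()), .inl (.inr ()))
        + ∑ j : Fin m, f (.inl (.inr ()), .inr (.inr j)) := by
  classical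
  rw [sum_edges]
  simp [bridgeGraph, Fintype.sum_sum_type]
  abel

@[simp] theorem inDeg_bridge_leaf (k m : ℕ) (i : Fin k) :
    degree (bridgeGraph k m) .inDeg (.inr (.inl i)) = 0 := by
  classical
  rw [degree_inDeg_eq, sum_edges_bridgeGraph]
  simp

@[simp] theorem inDeg_bridge_source (k m : ℕ) :
    degree (bridgeGraph k m) .inDeg (.inl (.inl ())) = k := by
  classical
  rw [degree_inDeg_eq, sum_edges_bridgeGraph]
  simp

@[simp] theorem inDeg_bridge_target (k m : ℕ) :
    degree (bridgeGraph k m) .inDeg (.inl (.inr ())) = 1 := by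
  classical
  rw [degree_inDeg_eq, sum_edges_bridgeGraph]
  simp

@[simp] theorem outDeg_bridge_source (k m : ℕ) :
    degree (bridgeGraph k m) .outDeg (.inl (.inl ())) = 1 := by
  classical
  rw [degree_outDeg_eq, sum_edges_bridgeGraph]
  simp

@[simp] theorem outDeg_bridge_target (k m : ℕ) :
    degree (bridgeGraph k m) .outDeg (.inl (.inr ())) = m := by
  classical
  rw [degree_outDeg_eq, sum_edges_bridgeGraph]
  simp

@[simp] theorem outDeg_bridge_leaf (k m : ℕ) (j : Fin m) :
    degree (bridgeGraph k m) .outDeg (.inr (.inr j)) = 0 := by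
  classical
  rw [degree_outDeg_eq, sum_edges_bridgeGraph]
  simp

end Graphs

/-- The in-degree `xᵢ + yᵢ` of the source of the `i`-th bridge. -/
def bridgeIn (x y : ℕ → ℕ) (i : ℕ) : ℝ := x i + y i

/-- The out-degree `⌊xᵢ + a yᵢ⌋` of the target of the `i`-th bridge. -/
def bridgeOut (a : ℝ) (x y : ℕ → ℕ) (i : ℕ) : ℝ := (⌊(x i : ℝ) + a * (y i : ℝ)⌋₊ : ℝ)

/-- The number of edges of a collection of bridge graphs. -/
def bridgeCard (a : ℝ) (x y : ℕ → ℕ) (n : ℕ) : ℝ :=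
  ∑ i ∈ Finset.range n, (bridgeIn x y i + bridgeOut a x y i + 1)

/-- The sum over all edges of the in-degree of the source. -/
def bridgeSum (a : ℝ) (x y : ℕ → ℕ) (n : ℕ) : ℝ :=
  ∑ i ∈ Finset.range n, (bridgeIn x y i + bridgeOut a x y i)

section Collection

variable (a : ℝ) (x y : ℕ → ℕ) (n : ℕ)

theorem card_edges_bridgeCollection :
    ((edges (bridgeCollection a x y n)).card : ℝ) = bridgeCard a x y n := by
  rw [Finset.cast_card, bridgeCollection, sum_edges_disjointUnion]
  simp_rw [sum_edges_bridgeGraph]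
  rw [bridgeCard, Finset.sum_range]
  refine Finset.sum_congr rfl fun i _ => ?_
  simp [bridgeIn, bridgeOut]
  ring

theorem edgeMean_bridgeCollection
    (f : (Σ i : Fin n, BridgeVertex (x i + y i) ⌊(x i : ℝ) + a * (y i : ℝ)⌋₊)
      × (Σ i : Fin n, BridgeVertex (x i + y i) ⌊(x i : ℝ) + a * (y i : ℝ)⌋₊) → ℝ) (g : ℕ → ℝ)
    (h : ∀ i : Fin n, ∑ e ∈ edges (bridgeGraph (x i + y i) ⌊(x i : ℝ) + a * (y i : ℝ)⌋₊),
      f (⟨i, e.1⟩, ⟨i, e.2⟩) = g i) :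
    edgeMean (bridgeCollection a x y n) f
      = (∑ i ∈ Finset.range n, g i) / bridgeCard a x y n := by
  rw [edgeMean, card_edges_bridgeCollection, bridgeCollection, sum_edges_disjointUnion,
    Finset.sum_congr rfl fun i _ => h i, Finset.sum_range, one_div_mul_eq_div]

/-- In `G(k, m)` the source in-degree is `0` on the `k` edges into `v`, `k` on the bridge and `1` on
the `m` edges out of `w`. -/
theorem sigmaSource_bridgeCollection :
    sigmaSource (bridgeCollection a x y n) .inDeg
      = √((∑ i ∈ Finset.range n, (bridgeIn x y i ^ 2 + bridgeOut a x y i)) / bridgeCard a x y n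
        - (bridgeSum a x y n / bridgeCard a x y n) ^ 2) := by
  rw [sigmaSource, edgeMean_bridgeCollection (g := fun i => bridgeIn x y i ^ 2 + bridgeOut a x y i),
    edgeMean_bridgeCollection (g := fun i => bridgeIn x y i + bridgeOut a x y i), bridgeSum]
  all_goals
    intro i
    simp [bridgeCollection, degree_disjointUnion, sum_edges_bridgeGraph, bridgeIn, bridgeOut]

/-- The mirror image: the target out-degree is `1` on `k` edges, `m` on the bridge and `0` on `m`
edges. The first moment is again `k + m`, so the same `bridgeSum` centres both variables. -/
theorem sigmaTarget_bridgeCollection :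
    sigmaTarget (bridgeCollection a x y n) .outDeg
      = √((∑ i ∈ Finset.range n, (bridgeIn x y i + bridgeOut a x y i ^ 2)) / bridgeCard a x y n
        - (bridgeSum a x y n / bridgeCard a x y n) ^ 2) := by
  rw [sigmaTarget, edgeMean_bridgeCollection (g := fun i => bridgeIn x y i + bridgeOut a x y i ^ 2),
    edgeMean_bridgeCollection (g := fun i => bridgeIn x y i + bridgeOut a x y i), bridgeSum]
  all_goals
    intro i
    simp [bridgeCollection, degree_disjointUnion, sum_edges_bridgeGraph, bridgeIn, bridgeOut]

theorem pearson_bridgeCollection :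
    pearson (bridgeCollection a x y n) .inDeg .outDeg
      = ((∑ i ∈ Finset.range n, bridgeIn x y i * bridgeOut a x y i) / bridgeCard a x y n
          - (bridgeSum a x y n / bridgeCard a x y n) ^ 2)
        / (sigmaSource (bridgeCollection a x y n) .inDeg
          * sigmaTarget (bridgeCollection a x y n) .outDeg) := by
  rw [pearson, one_div_mul_eq_div,
    edgeMean_bridgeCollection (g := fun i => bridgeIn x y i * bridgeOut a x y i),
    edgeMean_bridgeCollection (g := fun i => bridgeIn x y i + bridgeOut a x y i),
    edgeMean_bridgeCollection (g := fun i => bridgeIn x y i + bridgeOut a x y i), bridgeSum, sq]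
  all_goals
    intro i
    simp [bridgeCollection, degree_disjointUnion, sum_edges_bridgeGraph, bridgeIn, bridgeOut]

end Collection

/-! ### Error terms -/

section Errors

variable {a : ℝ} (x y : ℕ → ℕ) (n : ℕ) (b : ℝ)

/-- The normalized sum of squares. -/
def sqSum (x : ℕ → ℕ) (n : ℕ) (b : ℝ) : ℝ := (∑ i ∈ Finset.range n, (x i : ℝ) ^ 2) / b

/-- The normalized sum of `(1 + xᵢ) (1 + yᵢ)`, which dominates all error terms. -/
def errSum (x y : ℕ → ℕ) (n : ℕ) (b : ℝ) : ℝ :=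
  (∑ i ∈ Finset.range n, (1 + (x i : ℝ)) * (1 + (y i : ℝ))) / b

/-- The normalized, centred edge sum of a quantity which is `g i` on the `i`-th bridge. -/
def centredSum (a : ℝ) (x y : ℕ → ℕ) (n : ℕ) (b : ℝ) (g : ℕ → ℝ) : ℝ :=
  ((∑ i ∈ Finset.range n, g i) - bridgeSum a x y n ^ 2 / bridgeCard a x y n) / b

/-- The difference between a normalized, centred edge sum and its main term. -/
def bridgeError (a : ℝ) (x y : ℕ → ℕ) (n : ℕ) (b : ℝ) (g : ℕ → ℝ) (d : ℝ) : ℝ :=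
  centredSum a x y n b g - (sqSum x n b + d * sqSum y n b)

theorem bridgeIn_nonneg (i : ℕ) : 0 ≤ bridgeIn x y i := by unfold bridgeIn; positivity

theorem bridgeOut_nonneg (i : ℕ) : 0 ≤ bridgeOut a x y i := by unfold bridgeOut; positivity

theorem exists_bridgeOut_eq (ha : 0 < a) (i : ℕ) :
    ∃ θ : ℝ, 0 ≤ θ ∧ θ ≤ 1 ∧ bridgeOut a x y i = x i + a * y i - θ := by
  have h0 : 0 ≤ (x i : ℝ) + a * y i := by positivity
  refine ⟨x i + a * y i - bridgeOut a x y i, ?_, ?_, by ring⟩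
  · have := Nat.floor_le h0
    unfold bridgeOut
    linarith
  · have := Nat.lt_floor_add_one ((x i : ℝ) + a * y i)
    unfold bridgeOut
    linarith

theorem bridgeSum_nonneg : 0 ≤ bridgeSum a x y n :=
  Finset.sum_nonneg fun i _ => add_nonneg (bridgeIn_nonneg x y i) (bridgeOut_nonneg x y i)

theorem bridgeSum_le_bridgeCard : bridgeSum a x y n ≤ bridgeCard a x y n :=
  Finset.sum_le_sum fun i _ => by linarith

theorem bridgeCard_pos (hn : 0 < n) : 0 < bridgeCard a x y n :=
  Finset.sum_pos (fun i _ => by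
    have := bridgeIn_nonneg x y i
    have := bridgeOut_nonneg (a := a) x y i
    positivity) ⟨0, Finset.mem_range.2 hn⟩

theorem bridgeSum_sq_div_le (ha : 0 < a) :
    bridgeSum a x y n ^ 2 / bridgeCard a x y n
      ≤ (2 + a) * ∑ i ∈ Finset.range n, (1 + (x i : ℝ)) * (1 + (y i : ℝ)) := by
  have h0 := bridgeSum_nonneg (a := a) x y n
  have h1 := bridgeSum_le_bridgeCard (a := a) x y n
  calc bridgeSum a x y n ^ 2 / bridgeCard a x y n ≤ bridgeCard a x y n := by
        refine div_le_of_le_mul₀ (h0.trans h1) (h0.trans h1) ?_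
        nlinarith
    _ ≤ ∑ i ∈ Finset.range n, (2 + a) * ((1 + (x i : ℝ)) * (1 + (y i : ℝ))) := by
        refine Finset.sum_le_sum fun i _ => ?_
        obtain ⟨θ, hθ0, hθ1, hθ⟩ := exists_bridgeOut_eq x y ha i
        have hx : (0 : ℝ) ≤ x i := by positivity
        have hy : (0 : ℝ) ≤ y i := by positivity
        rw [hθ, bridgeIn]
        nlinarith [mul_nonneg hx hy, mul_nonneg ha.le (mul_nonneg hx hy), mul_nonneg ha.le hx,
          mul_nonneg ha.le hy]
    _ = _ := by rw [Finset.mul_sum]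

/-- The constant is the sum of `3 + 2 * a` from the pointwise errors and `2 + a` from the centring
term. The former is chosen large enough for all three choices of `g`. -/
theorem abs_bridgeError_le (ha : 0 < a) (hb : 0 < b) {g : ℕ → ℝ} {d : ℝ}
    (hg : ∀ i, |g i - ((x i : ℝ) ^ 2 + d * (y i : ℝ) ^ 2)|
      ≤ (3 + 2 * a) * ((1 + (x i : ℝ)) * (1 + (y i : ℝ)))) :
    |bridgeError a x y n b g d| ≤ (5 + 3 * a) * errSum x y n b := by
  have h1 := bridgeSum_sq_div_le x y n ha
  have h2 : 0 ≤ bridgeSum a x y n ^ 2 / bridgeCard a x y n :=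
    div_nonneg (sq_nonneg _) ((bridgeSum_nonneg x y n).trans (bridgeSum_le_bridgeCard x y n))
  have h3 : |∑ i ∈ Finset.range n, (g i - ((x i : ℝ) ^ 2 + d * (y i : ℝ) ^ 2))|
      ≤ (3 + 2 * a) * ∑ i ∈ Finset.range n, (1 + (x i : ℝ)) * (1 + (y i : ℝ)) := by
    rw [Finset.mul_sum]
    exact (Finset.abs_sum_le_sum_abs _ _).trans (Finset.sum_le_sum fun i _ => hg i)
  have h4 : bridgeError a x y n b g d
      = (∑ i ∈ Finset.range n, (g i - ((x i : ℝ) ^ 2 + d * (y i : ℝ) ^ 2))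
          - bridgeSum a x y n ^ 2 / bridgeCard a x y n) / b := by
    rw [bridgeError, centredSum, sqSum, sqSum, Finset.sum_sub_distrib, Finset.sum_add_distrib,
      ← Finset.mul_sum]
    ring
  rw [h4, abs_div, abs_of_pos hb, errSum, ← mul_div_assoc, div_le_div_iff_of_pos_right hb]
  refine (abs_sub _ _).trans ?_
  rw [abs_of_nonneg h2]
  linarith

theorem abs_bridgeError_cross_le (ha : 0 < a) (hb : 0 < b) :
    |bridgeError a x y n b (fun i => bridgeIn x y i * bridgeOut a x y i) a|
      ≤ (5 + 3 * a) * errSum x y n b := by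
  refine abs_bridgeError_le x y n b ha hb fun i => ?_
  obtain ⟨θ, hθ0, hθ1, hθ⟩ := exists_bridgeOut_eq x y ha i
  have hx : (0 : ℝ) ≤ x i := by positivity
  have hy : (0 : ℝ) ≤ y i := by positivity
  have h1 := mul_nonneg hx hy
  have h2 := mul_nonneg ha.le h1
  have h3 := mul_nonneg ha.le hx
  have h4 := mul_nonneg ha.le hy
  rw [hθ, bridgeIn, abs_le]
  constructor <;> nlinarith [mul_nonneg hθ0 hx, mul_nonneg hθ0 hy,
    mul_nonneg (sub_nonneg.2 hθ1) hx, mul_nonneg (sub_nonneg.2 hθ1) hy]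

theorem abs_bridgeError_source_le (ha : 0 < a) (hb : 0 < b) :
    |bridgeError a x y n b (fun i => bridgeIn x y i ^ 2 + bridgeOut a x y i) 1|
      ≤ (5 + 3 * a) * errSum x y n b := by
  refine abs_bridgeError_le x y n b ha hb fun i => ?_
  obtain ⟨θ, hθ0, hθ1, hθ⟩ := exists_bridgeOut_eq x y ha i
  have hx : (0 : ℝ) ≤ x i := by positivity
  have hy : (0 : ℝ) ≤ y i := by positivity
  have h1 := mul_nonneg hx hy
  have h2 := mul_nonneg ha.le h1
  have h3 := mul_nonneg ha.le hx
  have h4 := mul_nonneg ha.le hy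
  rw [hθ, bridgeIn, abs_le]
  constructor <;> nlinarith

theorem abs_bridgeError_target_le (ha : 0 < a) (hb : 0 < b) :
    |bridgeError a x y n b (fun i => bridgeIn x y i + bridgeOut a x y i ^ 2) (a ^ 2)|
      ≤ (5 + 3 * a) * errSum x y n b := by
  refine abs_bridgeError_le x y n b ha hb fun i => ?_
  obtain ⟨θ, hθ0, hθ1, hθ⟩ := exists_bridgeOut_eq x y ha i
  have hx : (0 : ℝ) ≤ x i := by positivity
  have hy : (0 : ℝ) ≤ y i := by positivity
  have h1 := mul_nonneg hx hy
  have h2 := mul_nonneg ha.le h1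
  have h3 := mul_nonneg ha.le hx
  have h4 := mul_nonneg ha.le hy
  have h5 : 0 ≤ θ * (x i + a * y i) := by positivity
  have h6 : 0 ≤ (1 - θ) * (x i + a * y i) := mul_nonneg (sub_nonneg.2 hθ1) (by positivity)
  have h7 : θ ^ 2 ≤ 1 := pow_le_one₀ hθ0 hθ1
  have h8 := sq_nonneg θ
  have h9 : bridgeIn x y i + (x i + a * y i - θ) ^ 2 - ((x i : ℝ) ^ 2 + a ^ 2 * (y i : ℝ) ^ 2)
      = x i + y i + 2 * (a * (x i * y i)) - 2 * (θ * (x i + a * y i)) + θ ^ 2 := by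
    unfold bridgeIn; ring
  rw [hθ, h9, abs_le]
  constructor <;> nlinarith

theorem centredSum_eq (g : ℕ → ℝ) (d : ℝ) :
    centredSum a x y n b g = sqSum x n b + d * sqSum y n b + bridgeError a x y n b g d := by
  rw [bridgeError]; ring

/-- The prefactor does not depend on `g`, so it cancels from the correlation coefficient and any
normalization `b` may be inserted. -/
theorem sub_sq_div_eq (hn : 0 < n) (hb : 0 < b) (g : ℕ → ℝ) :
    (∑ i ∈ Finset.range n, g i) / bridgeCard a x y n - (bridgeSum a x y n / bridgeCard a x y n) ^ 2
      = b / bridgeCard a x y n * centredSum a x y n b g := by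
  have := (bridgeCard_pos (a := a) x y n hn).ne'
  rw [centredSum]
  field_simp

theorem sigmaSource_eq (hn : 0 < n) (hb : 0 < b) :
    sigmaSource (bridgeCollection a x y n) .inDeg = √(b / bridgeCard a x y n)
      * √(centredSum a x y n b fun i => bridgeIn x y i ^ 2 + bridgeOut a x y i) := by
  rw [sigmaSource_bridgeCollection, sub_sq_div_eq x y n b hn hb,
    Real.sqrt_mul (div_pos hb (bridgeCard_pos x y n hn)).le]

theorem sigmaTarget_eq (hn : 0 < n) (hb : 0 < b) :
    sigmaTarget (bridgeCollection a x y n) .outDeg = √(b / bridgeCard a x y n)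
      * √(centredSum a x y n b fun i => bridgeIn x y i + bridgeOut a x y i ^ 2) := by
  rw [sigmaTarget_bridgeCollection, sub_sq_div_eq x y n b hn hb,
    Real.sqrt_mul (div_pos hb (bridgeCard_pos x y n hn)).le]

theorem sigma_pos_iff (hn : 0 < n) (hb : 0 < b) :
    (0 < sigmaSource (bridgeCollection a x y n) .inDeg
        ∧ 0 < sigmaTarget (bridgeCollection a x y n) .outDeg)
      ↔ (0 < centredSum a x y n b fun i => bridgeIn x y i ^ 2 + bridgeOut a x y i)
        ∧ 0 < centredSum a x y n b fun i => bridgeIn x y i + bridgeOut a x y i ^ 2 := by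
  have h : 0 < √(b / bridgeCard a x y n) :=
    Real.sqrt_pos.2 (div_pos hb (bridgeCard_pos x y n hn))
  rw [sigmaSource_eq x y n b hn hb, sigmaTarget_eq x y n b hn hb, mul_pos_iff_of_pos_left h,
    mul_pos_iff_of_pos_left h, Real.sqrt_pos, Real.sqrt_pos]

theorem pearson_eq (hb : 0 < b) :
    pearson (bridgeCollection a x y n) .inDeg .outDeg
      = centredSum a x y n b (fun i => bridgeIn x y i * bridgeOut a x y i)
        / (√(centredSum a x y n b fun i => bridgeIn x y i ^ 2 + bridgeOut a x y i)
          * √(centredSum a x y n b fun i => bridgeIn x y i + bridgeOut a x y i ^ 2)) := by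
  rw [pearson_bridgeCollection]
  -- With no edges both sides are `0`, by the convention for division by zero.
  rcases n.eq_zero_or_pos with rfl | hn
  · simp [centredSum, bridgeSum, bridgeCard]
  · have h : 0 < b / bridgeCard a x y n := div_pos hb (bridgeCard_pos x y n hn)
    rw [sigmaSource_eq x y n b hn hb, sigmaTarget_eq x y n b hn hb, sub_sq_div_eq x y n b hn hb,
      mul_mul_mul_comm, Real.mul_self_sqrt h.le, mul_div_mul_left _ _ h.ne']

end Errors

/-! ### The limiting correlation -/

/-- The limit of the correlation coefficient as a function of the two stable variables. -/
def limitCorr (a s t : ℝ) : ℝ := (s + a * t) / (√(s + t) * √(s + a ^ 2 * t))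

section LimitCorr

variable {a s t : ℝ}

theorem limitCorr_pos (ha : 0 < a) (hs : 0 < s) (ht : 0 < t) : 0 < limitCorr a s t := by
  unfold limitCorr; positivity

theorem limitCorr_sq (hs : 0 < s) (ht : 0 < t) :
    limitCorr a s t ^ 2 * ((s + t) * (s + a ^ 2 * t)) = (s + a * t) ^ 2 := by
  have h1 : 0 < s + t := by positivity
  have h2 : 0 < s + a ^ 2 * t := by positivity
  rw [limitCorr, div_pow, mul_pow, Real.sq_sqrt h1.le, Real.sq_sqrt h2.le]
  field_simp

/-- Strict Cauchy–Schwarz: `(s + t) (s + a² t) - (s + a t)² = s t (1 - a)²`. -/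
theorem limitCorr_lt_one (ha : 0 < a) (ha1 : a ≠ 1) (hs : 0 < s) (ht : 0 < t) :
    limitCorr a s t < 1 := by
  have h := limitCorr_sq (a := a) hs ht
  have h0 := limitCorr_pos ha hs ht
  have h1 : 0 < (s + t) * (s + a ^ 2 * t) := by positivity
  have h2 : 0 < s * t * (1 - a) ^ 2 := by
    have : 0 < (1 - a) ^ 2 := by have := sub_ne_zero.2 ha1.symm; positivity
    positivity
  by_contra hcon
  have h3 : 1 ≤ limitCorr a s t ^ 2 := one_le_pow₀ (not_lt.1 hcon)
  nlinarith

/-- From `(1 + a)² (s + a t)² - 4 a (s + t) (s + a² t) = (1 - a)² (s - a t)²`; the lower bound is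
attained exactly on the line `s = a t`. -/
theorem lt_limitCorr (ha : 0 < a) (ha1 : a ≠ 1) (hs : 0 < s) (ht : 0 < t) (hst : s ≠ a * t) :
    2 * √a / (1 + a) < limitCorr a s t := by
  have h := limitCorr_sq (a := a) hs ht
  have h0 := limitCorr_pos ha hs ht
  have h1 : 0 < (s + t) * (s + a ^ 2 * t) := by positivity
  have h2 : 0 < (1 - a) ^ 2 * (s - a * t) ^ 2 := by
    have := sub_ne_zero.2 ha1.symm
    have := sub_ne_zero.2 hst
    positivity
  refine lt_of_pow_lt_pow_left₀ 2 h0.le ?_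
  rw [div_pow, mul_pow, Real.sq_sqrt ha.le, div_lt_iff₀ (by positivity)]
  refine lt_of_mul_lt_mul_right ?_ h1.le
  calc 2 ^ 2 * a * ((s + t) * (s + a ^ 2 * t)) < (1 + a) ^ 2 * (s + a * t) ^ 2 := by nlinarith
    _ = limitCorr a s t ^ 2 * (1 + a) ^ 2 * ((s + t) * (s + a ^ 2 * t)) := by rw [← h]; ring

/-- After squaring, the equation is quadratic in `t` with leading coefficient `a² (1 - x²)`, nonzero
for `0 < x < 1`. Other values of `x` are not attained. -/
theorem finite_limitCorr_eq (ha : 0 < a) (ha1 : a ≠ 1) (hs : 0 < s) (x : ℝ) :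
    {t : ℝ | 0 < t ∧ limitCorr a s t = x}.Finite := by
  by_cases hx : 0 < x ∧ x < 1
  · have hlead : a ^ 2 * (1 - x ^ 2) ≠ 0 := by
      have : 0 < 1 - x ^ 2 := by nlinarith
      positivity
    set p : Polynomial ℝ := Polynomial.C (a ^ 2 * (1 - x ^ 2)) * Polynomial.X ^ 2
      + Polynomial.C (s * (2 * a - x ^ 2 * (1 + a ^ 2))) * Polynomial.X
      + Polynomial.C (s ^ 2 * (1 - x ^ 2)) with hp
    have hp0 : p ≠ 0 := fun h0 => hlead (by
      have := Polynomial.leadingCoeff_quadratic (b := s * (2 * a - x ^ 2 * (1 + a ^ 2)))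
        (c := s ^ 2 * (1 - x ^ 2)) hlead
      rw [← this, ← hp, h0, Polynomial.leadingCoeff_zero])
    refine (Polynomial.finite_setOfPred_isRoot hp0).subset fun t ht => ?_
    have h := limitCorr_sq (a := a) hs ht.1
    rw [ht.2] at h
    simp only [Set.mem_ofPred_eq, Polynomial.IsRoot, hp, Polynomial.eval_add, Polynomial.eval_mul,
      Polynomial.eval_C, Polynomial.eval_pow, Polynomial.eval_X]
    linarith
  · refine Set.finite_empty.subset fun t ht => hx ⟨?_, ?_⟩
    · rw [← ht.2]
      exact limitCorr_pos ha hs ht.1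
    · rw [← ht.2]
      exact limitCorr_lt_one ha ha1 hs ht.1

end LimitCorr

/-! ### Range and non-degeneracy of the limit law -/

section LimitLaw

variable {μ ν : Measure ℝ} {a : ℝ}

theorem ae_fst_pos (hμ : ∀ᵐ x ∂μ, 0 < x) : ∀ᵐ z ∂μ.prod ν, 0 < z.1 :=
  Measure.quasiMeasurePreserving_fst.ae hμ

theorem ae_snd_pos (hν : ∀ᵐ x ∂ν, 0 < x) : ∀ᵐ z ∂μ.prod ν, 0 < z.2 :=
  Measure.quasiMeasurePreserving_snd.ae hν

variable [IsProbabilityMeasure ν]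

theorem ae_limitCorr_mem_Ioo (hμ : ∀ᵐ x ∂μ, 0 < x) (hν : ∀ᵐ x ∂ν, 0 < x)
    (hatom : ∀ x, ν {x} = 0) (ha : 0 < a) (ha1 : a ≠ 1) :
    ∀ᵐ z ∂μ.prod ν, limitCorr a z.1 z.2 ∈ Set.Ioo (2 * √a / (1 + a)) 1 := by
  -- Each section of the exceptional line is a single point, which is null for the atomless `ν`.
  have hne : ∀ᵐ z ∂μ.prod ν, z.1 ≠ a * z.2 := by
    rw [ae_iff]
    have hm : MeasurableSet {z : ℝ × ℝ | ¬ z.1 ≠ a * z.2} := by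
      simp only [not_not]
      exact measurableSet_eq_fun measurable_fst (measurable_snd.const_mul a)
    rw [Measure.measure_prod_null hm]
    refine Eventually.of_forall fun s => measure_mono_null (t := {s / a}) ?_ (hatom _)
    intro t ht
    have h : s = a * t := not_not.1 ht
    rw [Set.mem_singleton_iff, h, mul_div_cancel_left₀ _ ha.ne']
  filter_upwards [hne, ae_fst_pos hμ, ae_snd_pos hν] with z h1 h2 h3
  exact ⟨lt_limitCorr ha ha1 h2 h3 h1, limitCorr_lt_one ha ha1 h2 h3⟩

theorem not_ae_limitCorr_eq [IsProbabilityMeasure μ] (hμ : ∀ᵐ x ∂μ, 0 < x) (hν : ∀ᵐ x ∂ν, 0 < x)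
    (hatom : ∀ x, ν {x} = 0) (ha : 0 < a) (ha1 : a ≠ 1) (x : ℝ) :
    ¬ ∀ᵐ z ∂μ.prod ν, limitCorr a z.1 z.2 = x := by
  intro h
  have : NullSingletonClass ν := ⟨hatom⟩
  obtain ⟨s, hs, hs0⟩ := ((Measure.ae_ae_of_ae_prod h).and hμ).exists
  have hfin := (finite_limitCorr_eq ha ha1 hs0 x).measure_zero ν
  have hmem : ∀ᵐ t ∂ν, t ∈ {t : ℝ | 0 < t ∧ limitCorr a s t = x} := by
    filter_upwards [hs, hν] with t h1 h2 using ⟨h2, h1⟩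
  obtain ⟨t, h1, h2⟩ := (hmem.and (measure_eq_zero_iff_ae_notMem.1 hfin)).exists
  exact h2 h1

end LimitLaw

theorem eq_of_eq_parameter {ε a : ℝ} (hε : 0 < ε) (hε1 : ε < 1)
    (ha : a = (2 - ε ^ 2 + 2 * √(1 - ε ^ 2)) / ε ^ 2 ∨
      a = (2 - ε ^ 2 - 2 * √(1 - ε ^ 2)) / ε ^ 2) :
    0 < a ∧ a ≠ 1 ∧ 2 * √a / (1 + a) = ε := by
  have h1 : 0 < 1 - ε ^ 2 := by nlinarith
  -- With `r = ±√(1 - ε²)` both parameters are the square of `(1 + r) / ε`, because `(1 + r)² = 2 -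
  -- ε² + 2 r`. This makes `√a` explicit.
  obtain ⟨r, hr2, hr1, har⟩ : ∃ r : ℝ, r ^ 2 = 1 - ε ^ 2 ∧ -1 < r ∧
      a = ((1 + r) / ε) ^ 2 := by
    have hs := Real.sq_sqrt h1.le
    have hs0 := Real.sqrt_pos.2 h1
    rcases ha with ha | ha
    · refine ⟨√(1 - ε ^ 2), hs, by linarith, ?_⟩
      rw [ha, div_pow]
      congr 1
      linarith
    · refine ⟨-√(1 - ε ^ 2), by rw [neg_sq, hs], by nlinarith, ?_⟩
      rw [ha, div_pow]
      congr 1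
      linarith
  have h2 : 0 < (1 + r) / ε := div_pos (by linarith) hε
  refine ⟨by rw [har]; positivity, fun h => ?_, ?_⟩
  · rw [har, pow_eq_one_iff_of_nonneg h2.le two_ne_zero, div_eq_one_iff_eq hε.ne'] at h
    rw [show r = ε - 1 by linarith] at hr2
    nlinarith [mul_pos hε (sub_pos.2 hε1)]
  · rw [har, Real.sqrt_sq h2.le]
    have h3 : 1 + ((1 + r) / ε) ^ 2 = 2 * (1 + r) / ε ^ 2 := by
      rw [div_pow]
      field_simp
      linarith
    rw [h3]
    have : 1 + r ≠ 0 := by linarith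
    field_simp

/-! ### Convergence of the normalized sums -/

theorem tendstoInDistribution_prodMk_of_indepFun {Ω : Type*} [MeasurableSpace Ω] {P : Measure Ω}
    [IsProbabilityMeasure P] {A B : ℕ → Ω → ℝ} (hA : ∀ n, Measurable (A n))
    (hB : ∀ n, Measurable (B n)) (hAB : ∀ n, IndepFun (A n) (B n) P) {μ ν : ProbabilityMeasure ℝ}
    (hμ : Tendsto (β := ProbabilityMeasure ℝ)
      (fun n => ⟨P.map (A n), Measure.isProbabilityMeasure_map (hA n).aemeasurable⟩) atTop (𝓝 μ))
    (hν : Tendsto (β := ProbabilityMeasure ℝ)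
      (fun n => ⟨P.map (B n), Measure.isProbabilityMeasure_map (hB n).aemeasurable⟩) atTop (𝓝 ν)) :
    TendstoInDistribution (fun n ω => (A n ω, B n ω)) atTop (fun z : ℝ × ℝ => z) (fun _ => P)
      ((μ : Measure ℝ).prod (ν : Measure ℝ)) where
  forall_aemeasurable n := ((hA n).prodMk (hB n)).aemeasurable
  aemeasurable_limit := aemeasurable_id
  tendsto := by
    have h := (ProbabilityMeasure.continuous_prod.tendsto (μ, ν)).comp (hμ.prodMk_nhds hν)
    have e : ∀ h' : IsProbabilityMeasure
        (((μ : Measure ℝ).prod (ν : Measure ℝ)).map fun z : ℝ × ℝ => z),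
        (⟨_, h'⟩ : ProbabilityMeasure (ℝ × ℝ)) = μ.prod ν := fun _ => Subtype.ext Measure.map_id
    rw [e]
    refine h.congr fun n => Subtype.ext ?_
    exact ((indepFun_iff_map_prod_eq_prod_map_map (hA n).aemeasurable (hB n).aemeasurable).1
      (hAB n)).symm

theorem exists_isPositiveStable_sqSum {Ω : Type*} [MeasurableSpace Ω] {P : Measure Ω}
    [IsProbabilityMeasure P] {X : ℕ → Ω → ℕ} (hmeas : ∀ i, Measurable (X i))
    (hindep : iIndepFun X P) (hident : ∀ i, IdentDistrib (X i) (X 0) P P) {γ : ℝ} (hγ : 0 < γ)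
    (hγ2 : γ < 2) (hF : IsRegularTail γ (fun t => P.real {ω | t < (X 0 ω : ℝ)})) {B : ℕ → ℝ}
    (hBpos : ∀ n, 0 < B n) (hBtop : Tendsto B atTop atTop) {c : ℝ} (hc : 0 < c)
    (hB : ∀ x : ℝ, 0 < x →
      Tendsto (fun n : ℕ => n * P.real {ω | B n * x < (X 0 ω : ℝ)}) atTop (𝓝 (c * x ^ (-γ))))
    (hA : ∀ n, Measurable fun ω => sqSum (fun i => X i ω) n (B n ^ 2)) :
    ∃ μ : ProbabilityMeasure ℝ, IsPositiveStable (γ / 2) (laplaceConst γ c) μ ∧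
      Tendsto (β := ProbabilityMeasure ℝ) (fun n => ⟨P.map fun ω => sqSum (fun i => X i ω) n (B n ^ 2),
        Measure.isProbabilityMeasure_map (hA n).aemeasurable⟩)
        atTop (𝓝 μ) := by
  refine exists_isPositiveStable_of_tendsto_laplace (by positivity)
    (mul_pos hc (Real.Gamma_pos_of_pos (by linarith))) (fun n => ?_) fun s hs => ?_
  · refine (ae_map_iff (hA n).aemeasurable measurableSet_Ici).2 (Eventually.of_forall fun ω => ?_)
    exact div_nonneg (Finset.sum_nonneg fun i _ => by positivity) (sq_nonneg _)
  · have h := tendsto_laplace_sum_sq (ξ := fun i ω => (X i ω : ℝ))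
      (fun i => measurable_from_top.comp (hmeas i)) (fun i ω => Nat.cast_nonneg _)
      (hindep.comp (fun _ => ((↑) : ℕ → ℝ)) fun _ => measurable_from_top)
      (fun i => (hident i).comp measurable_from_top) hγ hγ2 hF hBpos hBtop hB hs
    refine h.congr fun n => ?_
    exact (integral_map (f := fun x => Real.exp (-(s * x))) (hA n).aemeasurable
      (by fun_prop)).symm

theorem tendstoInMeasure_errSum {Ω : Type*} [MeasurableSpace Ω] {P : Measure Ω}
    [IsProbabilityMeasure P] {X Y : ℕ → Ω → ℕ} (hX : ∀ i, Measurable (X i))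
    (hY : ∀ i, Measurable (Y i)) (hXY : ∀ i, IndepFun (X i) (Y i) P)
    (hX_ident : ∀ i, IdentDistrib (X i) (X 0) P P) (hY_ident : ∀ i, IdentDistrib (Y i) (Y 0) P P)
    {γ : ℝ} (hγ : 0 < γ) (hγ2 : γ < 2) (hF : IsRegularTail γ (fun t => P.real {ω | t < (X 0 ω : ℝ)}))
    (hG : IsRegularTail γ (fun t => P.real {ω | t < (Y 0 ω : ℝ)})) {B : ℕ → ℝ}
    (hBpos : ∀ n, 0 < B n)
    (hB : ∀ r : ℝ, γ < r → Tendsto (fun n : ℕ => n / B n ^ r) atTop (𝓝 0)) :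
    TendstoInMeasure P (fun n ω => errSum (fun i => X i ω) (fun i => Y i ω) n (B n ^ 2)) atTop
      (fun _ => (0 : ℝ)) := by
  -- `q < γ` gives finite moments, `q ≤ 1` subadditivity, and `2 q > γ` makes `n / B n ^ (2 q)`
  -- vanish. Such `q` exist because `0 < γ < 2`.
  obtain ⟨q, hq1, hq2⟩ := exists_between (show γ / 2 < min γ 1 from
    lt_min (by linarith) (by linarith))
  have hq0 : 0 < q := by linarith
  have hqγ : q < γ := hq2.trans_le (min_le_left _ _)
  have hq1' : q ≤ 1 := (hq2.trans_le (min_le_right _ _)).le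
  set u : ℕ → ℝ := fun k => (1 + (k : ℝ)) ^ q with hu
  have hum : Measurable u := measurable_from_top
  have hXint : ∀ i, Integrable (fun ω => u (X i ω)) P := fun i =>
    ((hX_ident i).comp hum).integrable_iff.2 (integrable_one_add_rpow
      (ξ := fun ω => (X 0 ω : ℝ)) (measurable_from_top.comp (hX 0)) (fun ω => Nat.cast_nonneg _)
      hq0 hq1' (integrable_rpow_of_tail (measurable_from_top.comp (hX 0))
        (fun ω => Nat.cast_nonneg _) hF hq0 hqγ))
  have hYint : ∀ i, Integrable (fun ω => u (Y i ω)) P := fun i =>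
    ((hY_ident i).comp hum).integrable_iff.2 (integrable_one_add_rpow
      (ξ := fun ω => (Y 0 ω : ℝ)) (measurable_from_top.comp (hY 0)) (fun ω => Nat.cast_nonneg _)
      hq0 hq1' (integrable_rpow_of_tail (measurable_from_top.comp (hY 0))
        (fun ω => Nat.cast_nonneg _) hG hq0 hqγ))
  have hT : ∀ i ω, ((1 + (X i ω : ℝ)) * (1 + (Y i ω : ℝ))) ^ q = u (X i ω) * u (Y i ω) :=
    fun i ω => Real.mul_rpow (by positivity) (by positivity)
  have hXYu : ∀ i, IndepFun (fun ω => u (X i ω)) (fun ω => u (Y i ω)) P := fun i =>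
    (hXY i).comp hum hum
  have hXu : ∀ i, ∫ ω, u (X i ω) ∂P = ∫ ω, u (X 0 ω) ∂P := fun i =>
    ((hX_ident i).comp hum).integral_eq
  have hYu : ∀ i, ∫ ω, u (Y i ω) ∂P = ∫ ω, u (Y 0 ω) ∂P := fun i =>
    ((hY_ident i).comp hum).integral_eq
  refine tendstoInMeasure_sum_div_zero
    (T := fun i ω => (1 + (X i ω : ℝ)) * (1 + (Y i ω : ℝ))) (fun i ω => by positivity) hq0 hq1'
    (M := (∫ ω, u (X 0 ω) ∂P) * ∫ ω, u (Y 0 ω) ∂P) (fun i => ?_) (fun i => ?_)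
    (fun n => pow_pos (hBpos n) 2) ?_
  · simp_rw [hT]
    exact (hXYu i).integrable_mul (hXint i) (hYint i)
  · simp_rw [hT]
    rw [(hXYu i).integral_fun_mul_eq_mul_integral (hXint i).aestronglyMeasurable
      (hYint i).aestronglyMeasurable, hXu i, hYu i]
  · refine (hB (2 * q) (by linarith)).congr fun n => ?_
    rw [Real.rpow_mul (hBpos n).le, Real.rpow_two]

theorem indepFun_sqSum {Ω : Type*} [MeasurableSpace Ω] {P : Measure Ω}
    {X Y : ℕ → Ω → ℕ} (hX : ∀ i, Measurable (X i)) (hY : ∀ i, Measurable (Y i))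
    (h : iIndepFun (Sum.elim X Y) P) (n : ℕ) (b : ℝ) :
    IndepFun (fun ω => sqSum (fun i => X i ω) n b) (fun ω => sqSum (fun i => Y i ω) n b) P := by
  set S : Finset (ℕ ⊕ ℕ) := (Finset.range n).map Function.Embedding.inl with hS
  set T : Finset (ℕ ⊕ ℕ) := (Finset.range n).map Function.Embedding.inr with hT
  have hdisj : Disjoint S T := by
    rw [Finset.disjoint_left]
    rintro _ h1 h2
    obtain ⟨i, -, rfl⟩ := Finset.mem_map.1 h1
    obtain ⟨j, -, hj⟩ := Finset.mem_map.1 h2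
    exact Sum.inr_ne_inl hj
  have hsum : ∀ U : Finset (ℕ ⊕ ℕ),
      Measurable fun v : U → ℕ => (∑ i, ((v i : ℕ) : ℝ) ^ 2) / b := fun U =>
    (Finset.measurable_sum _ fun i _ =>
      (measurable_from_top.comp (measurable_pi_apply i)).pow_const 2).div_const b
  have hind := (h.indepFun_finset S T hdisj (Sum.rec hX hY)).comp (hsum S) (hsum T)
  convert! hind using 1
  · ext ω
    simp only [sqSum, Function.comp]
    rw [Finset.sum_coe_sort S fun i => ((Sum.elim X Y i ω : ℕ) : ℝ) ^ 2, hS, Finset.sum_map]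
    rfl
  · ext ω
    simp only [sqSum, Function.comp]
    rw [Finset.sum_coe_sort T fun i => ((Sum.elim X Y i ω : ℕ) : ℝ) ^ 2, hT, Finset.sum_map]
    rfl

/-! ### Convergence of the correlation coefficient -/

/-- Portmanteau: the limit law charges only `U`, so the frontier of `U` is null. -/
theorem tendsto_measureReal_of_isOpen {Ω Ω' E : Type*} [MeasurableSpace Ω] [MeasurableSpace Ω']
    [TopologicalSpace E] [MeasurableSpace E] [OpensMeasurableSpace E] [HasOuterApproxClosed E]
    {P : Measure Ω} [IsProbabilityMeasure P] {Q : Measure Ω'} [IsProbabilityMeasure Q]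
    {X : ℕ → Ω → E} {Z : Ω' → E} (h : TendstoInDistribution X atTop Z (fun _ => P) Q) {U : Set E}
    (hU : IsOpen U) (hZ : ∀ᵐ ω ∂Q, Z ω ∈ U) :
    Tendsto (fun n => P.real {ω | X n ω ∈ U}) atTop (𝓝 1) := by
  have hlim : (Q.map Z) Uᶜ = 0 := by
    rw [Measure.map_apply_of_aemeasurable h.aemeasurable_limit hU.measurableSet.compl]
    exact hZ
  have hfr : (Q.map Z) (frontier U) = 0 :=
    measure_mono_null (by rw [hU.frontier_eq]; exact fun x hx => hx.2) hlim
  have hone : (Q.map Z) U = 1 := by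
    have := Measure.isProbabilityMeasure_map h.aemeasurable_limit
    exact (prob_compl_eq_zero_iff hU.measurableSet).1 hlim
  have h1 := ProbabilityMeasure.tendsto_measure_of_null_frontier_of_tendsto' h.tendsto hfr
  have h2 : Tendsto (fun n => (P.map (X n)) U) atTop (𝓝 1) := by
    rw [← hone]; exact h1
  have h3 := (ENNReal.tendsto_toReal ENNReal.one_ne_top).comp h2
  refine h3.congr fun n => ?_
  simp only [Function.comp]
  rw [Measure.map_apply_of_aemeasurable (h.forall_aemeasurable n) hU.measurableSet]
  rfl

theorem tendstoInMeasure_zero_of_norm_le {Ω E : Type*} [MeasurableSpace Ω] {P : Measure Ω}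
    [IsProbabilityMeasure P] [NormedAddCommGroup E] {f : ℕ → Ω → E} {g : ℕ → Ω → ℝ} {K : ℝ}
    (hK : 0 < K) (hg : TendstoInMeasure P g atTop (fun _ => (0 : ℝ)))
    (hfg : ∀ n ω, ‖f n ω‖ ≤ K * g n ω) : TendstoInMeasure P f atTop (fun _ => (0 : E)) := by
  rw [tendstoInMeasure_iff_measureReal_norm] at hg ⊢
  intro ε hε
  refine squeeze_zero (fun n => measureReal_nonneg) (fun n => measureReal_mono fun ω hω => ?_)
    (hg (ε / K) (by positivity))
  simp only [Set.mem_ofPred_eq, sub_zero] at hω ⊢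
  rw [div_le_iff₀ hK, mul_comm]
  exact (hω.trans (hfg n ω)).trans (by gcongr; exact le_abs_self _)

section Collection

variable {Ω : Type*} [MeasurableSpace Ω] {P : Measure Ω} {X Y : ℕ → Ω → ℕ} {a : ℝ}

theorem measurable_bridgeIn (hX : ∀ i, Measurable (X i)) (hY : ∀ i, Measurable (Y i)) (i : ℕ) :
    Measurable fun ω => bridgeIn (fun i => X i ω) (fun i => Y i ω) i :=
  (measurable_from_top.comp (hX i)).add (measurable_from_top.comp (hY i))

theorem measurable_bridgeOut (hX : ∀ i, Measurable (X i)) (hY : ∀ i, Measurable (Y i)) (i : ℕ) :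
    Measurable fun ω => bridgeOut a (fun i => X i ω) (fun i => Y i ω) i := by
  have hx : Measurable fun ω => (X i ω : ℝ) := measurable_from_top.comp (hX i)
  have hy : Measurable fun ω => (Y i ω : ℝ) := measurable_from_top.comp (hY i)
  exact measurable_from_top.comp (Nat.measurable_floor.comp (hx.add (hy.const_mul a)))

theorem measurable_sqSum (hX : ∀ i, Measurable (X i)) (n : ℕ) (b : ℝ) :
    Measurable fun ω => sqSum (fun i => X i ω) n b :=
  (Finset.measurable_sum _ fun i _ => (measurable_from_top.comp (hX i)).pow_const 2).div_const b

theorem measurable_bridgeError (hX : ∀ i, Measurable (X i)) (hY : ∀ i, Measurable (Y i)) (n : ℕ)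
    (b d : ℝ) {g : Ω → ℕ → ℝ} (hg : ∀ i, Measurable fun ω => g ω i) :
    Measurable fun ω => bridgeError a (fun i => X i ω) (fun i => Y i ω) n b (g ω) d := by
  have hin := measurable_bridgeIn hX hY
  have hout := measurable_bridgeOut (a := a) hX hY
  have hx := measurable_sqSum hX n b
  have hy := measurable_sqSum hY n b
  have hS : Measurable fun ω => bridgeSum a (fun i => X i ω) (fun i => Y i ω) n :=
    Finset.measurable_sum _ fun i _ => (hin i).add (hout i)
  have hN : Measurable fun ω => bridgeCard a (fun i => X i ω) (fun i => Y i ω) n :=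
    Finset.measurable_sum _ fun i _ => ((hin i).add (hout i)).add_const 1
  exact ((((Finset.measurable_sum _ fun i _ => hg i).sub ((hS.pow_const 2).div hN)).div_const b).sub
    (hx.add (hy.const_mul d)))

/-- The three error terms in the numerator and the denominator of the correlation coefficient. -/
def errorVec (a : ℝ) (x y : ℕ → ℕ) (n : ℕ) (b : ℝ) : ℝ × ℝ × ℝ :=
  (bridgeError a x y n b (fun i => bridgeIn x y i * bridgeOut a x y i) a,
    bridgeError a x y n b (fun i => bridgeIn x y i ^ 2 + bridgeOut a x y i) 1,
    bridgeError a x y n b (fun i => bridgeIn x y i + bridgeOut a x y i ^ 2) (a ^ 2))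

theorem measurable_errorVec (hX : ∀ i, Measurable (X i)) (hY : ∀ i, Measurable (Y i)) (n : ℕ)
    (b : ℝ) : Measurable fun ω => errorVec a (fun i => X i ω) (fun i => Y i ω) n b := by
  have hin := measurable_bridgeIn hX hY
  have hout := measurable_bridgeOut (a := a) hX hY
  exact (measurable_bridgeError hX hY n b _ fun i => (hin i).mul (hout i)).prodMk
    ((measurable_bridgeError hX hY n b _ fun i => ((hin i).pow_const 2).add (hout i)).prodMk
      (measurable_bridgeError hX hY n b _ fun i => (hin i).add ((hout i).pow_const 2)))

theorem norm_errorVec_le (ha : 0 < a) (x y : ℕ → ℕ) (n : ℕ) {b : ℝ} (hb : 0 < b) :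
    ‖errorVec a x y n b‖ ≤ (5 + 3 * a) * errSum x y n b :=
  norm_prod_le_iff.2 ⟨abs_bridgeError_cross_le x y n b ha hb,
    norm_prod_le_iff.2 ⟨abs_bridgeError_source_le x y n b ha hb,
      abs_bridgeError_target_le x y n b ha hb⟩⟩

/-- The correlation coefficient as a function of the normalized sums of squares and the error
terms. -/
def corrFun (a : ℝ) (z : (ℝ × ℝ) × (ℝ × ℝ × ℝ)) : ℝ :=
  (z.1.1 + a * z.1.2 + z.2.1)
    / (√(z.1.1 + 1 * z.1.2 + z.2.2.1) * √(z.1.1 + a ^ 2 * z.1.2 + z.2.2.2))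

theorem pearson_eq_corrFun (x y : ℕ → ℕ) (n : ℕ) {b : ℝ} (hb : 0 < b) :
    pearson (bridgeCollection a x y n) .inDeg .outDeg
      = corrFun a ((sqSum x n b, sqSum y n b), errorVec a x y n b) := by
  rw [pearson_eq x y n b hb, centredSum_eq x y n b _ a, centredSum_eq x y n b _ 1,
    centredSum_eq x y n b _ (a ^ 2), corrFun, errorVec]

variable [IsProbabilityMeasure P] {μ ν : Measure ℝ} [IsProbabilityMeasure μ]
  [IsProbabilityMeasure ν] {b : ℕ → ℝ}

theorem tendstoInDistribution_errorVec (hX : ∀ i, Measurable (X i)) (hY : ∀ i, Measurable (Y i))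
    (hb : ∀ n, 0 < b n)
    (h : TendstoInDistribution (fun n ω => (sqSum (fun i => X i ω) n (b n),
      sqSum (fun i => Y i ω) n (b n))) atTop (fun z : ℝ × ℝ => z) (fun _ => P) (μ.prod ν))
    (herr : TendstoInMeasure P (fun n ω => errSum (fun i => X i ω) (fun i => Y i ω) n (b n)) atTop
      (fun _ => (0 : ℝ))) (ha : 0 < a) :
    TendstoInDistribution (fun n ω => ((sqSum (fun i => X i ω) n (b n),
      sqSum (fun i => Y i ω) n (b n)), errorVec a (fun i => X i ω) (fun i => Y i ω) n (b n))) atTop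
      (fun z : ℝ × ℝ => (z, (0 : ℝ × ℝ × ℝ))) (fun _ => P) (μ.prod ν) :=
  h.prodMk_of_tendstoInMeasure_const _ _ _
    (tendstoInMeasure_zero_of_norm_le (by positivity) herr fun n _ =>
      norm_errorVec_le ha _ _ n (hb n))
    fun n => (measurable_errorVec hX hY n (b n)).aemeasurable

theorem tendsto_measureReal_sigma_pos (hX : ∀ i, Measurable (X i)) (hY : ∀ i, Measurable (Y i))
    (hb : ∀ n, 0 < b n)
    (h : TendstoInDistribution (fun n ω => (sqSum (fun i => X i ω) n (b n),
      sqSum (fun i => Y i ω) n (b n))) atTop (fun z : ℝ × ℝ => z) (fun _ => P) (μ.prod ν))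
    (herr : TendstoInMeasure P (fun n ω => errSum (fun i => X i ω) (fun i => Y i ω) n (b n)) atTop
      (fun _ => (0 : ℝ))) (hμ : ∀ᵐ x ∂μ, 0 < x) (hν : ∀ᵐ x ∂ν, 0 < x) (ha : 0 < a) :
    Tendsto (fun n : ℕ => P.real {ω |
        0 < sigmaSource (bridgeCollection a (fun i => X i ω) (fun i => Y i ω) n) .inDeg ∧
        0 < sigmaTarget (bridgeCollection a (fun i => X i ω) (fun i => Y i ω) n) .outDeg})
      atTop (𝓝 1) := by
  have hU : IsOpen {z : (ℝ × ℝ) × (ℝ × ℝ × ℝ) | 0 < z.1.1 + 1 * z.1.2 + z.2.2.1 ∧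
      0 < z.1.1 + a ^ 2 * z.1.2 + z.2.2.2} := by
    rw [Set.ofPred_and]
    exact (isOpen_lt (by fun_prop) (by fun_prop)).inter (isOpen_lt (by fun_prop) (by fun_prop))
  have hlim := tendsto_measureReal_of_isOpen (tendstoInDistribution_errorVec hX hY hb h herr ha) hU
    (by
      filter_upwards [ae_fst_pos hμ, ae_snd_pos hν] with z h1 h2
      have h3 : 0 < a ^ 2 * z.2 := by positivity
      exact ⟨by simpa using by linarith, by simpa using by linarith⟩)
  refine hlim.congr' ?_
  filter_upwards [eventually_gt_atTop 0] with n hn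
  congr 1
  ext ω
  simp only [Set.mem_ofPred_eq]
  rw [sigma_pos_iff _ _ n (b n) hn (hb n), centredSum_eq _ _ n (b n) _ 1,
    centredSum_eq _ _ n (b n) _ (a ^ 2)]
  rfl

theorem measurable_corrFun : Measurable (corrFun a) := by
  unfold corrFun; fun_prop

theorem tendstoInDistribution_pearson (hX : ∀ i, Measurable (X i)) (hY : ∀ i, Measurable (Y i))
    (hb : ∀ n, 0 < b n)
    (h : TendstoInDistribution (fun n ω => (sqSum (fun i => X i ω) n (b n),
      sqSum (fun i => Y i ω) n (b n))) atTop (fun z : ℝ × ℝ => z) (fun _ => P) (μ.prod ν))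
    (herr : TendstoInMeasure P (fun n ω => errSum (fun i => X i ω) (fun i => Y i ω) n (b n)) atTop
      (fun _ => (0 : ℝ))) (hμ : ∀ᵐ x ∂μ, 0 < x) (hν : ∀ᵐ x ∂ν, 0 < x) (ha : 0 < a) :
    TendstoInDistribution
      (fun n ω => pearson (bridgeCollection a (fun i => X i ω) (fun i => Y i ω) n) .inDeg .outDeg)
      atTop (fun z : ℝ × ℝ => limitCorr a z.1 z.2) (fun _ => P) (μ.prod ν) := by
  have hlim := tendstoInDistribution_comp_of_ae_continuousAt
    (tendstoInDistribution_errorVec hX hY hb h herr ha) (measurable_corrFun (a := a)) (by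
      filter_upwards [ae_fst_pos hμ, ae_snd_pos hν] with z h1 h2
      refine ContinuousAt.div (by fun_prop) (by fun_prop) ?_
      have h3 : 0 < √(z.1 + 1 * z.2 + 0) := Real.sqrt_pos.2 (by linarith)
      have h4 : 0 < √(z.1 + a ^ 2 * z.2 + 0) := Real.sqrt_pos.2 (by positivity)
      exact (mul_pos h3 h4).ne')
    (fun n => ((measurable_sqSum hX n _).prodMk (measurable_sqSum hY n _)).prodMk
      (measurable_errorVec hX hY n _)) (by fun_prop)
  have e1 : (fun z : ℝ × ℝ => corrFun a (z, (0 : ℝ × ℝ × ℝ)))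
      = fun z : ℝ × ℝ => limitCorr a z.1 z.2 := by
    funext z
    simp [corrFun, limitCorr]
  have e2 : (fun n ω => corrFun a ((sqSum (fun i => X i ω) n (b n),
      sqSum (fun i => Y i ω) n (b n)), errorVec a (fun i => X i ω) (fun i => Y i ω) n (b n)))
      = fun n ω => pearson (bridgeCollection a (fun i => X i ω) (fun i => Y i ω) n)
        .inDeg .outDeg := by
    funext n ω
    rw [pearson_eq_corrFun _ _ n (hb n)]
  rw [← e1, ← e2]
  exact hlim

end Collection

end DegreeCorrelation

end

/-! ### Common normalization and the product space of the limits -/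

theorem mainTheorem5 {Ω : Type*} [MeasurableSpace Ω] (P : Measure Ω) [IsProbabilityMeasure P]
    (γ : ℝ) (hγ_pos : 0 < γ) (hγ_lt : γ < 2)
    (X Y : ℕ → Ω → ℕ)
    (hX_meas : ∀ i, Measurable (X i)) (hY_meas : ∀ i, Measurable (Y i))
    (h_indep : iIndepFun (Sum.elim X Y) P)
    (hX_ident : ∀ i, IdentDistrib (X i) (X 0) P P)
    (hY_ident : ∀ i, IdentDistrib (Y i) (Y 0) P P)
    (hX_rv : DegreeCorrelation.IsRegularlyVarying P (fun ω => (X 0 ω : ℝ)) γ)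
    (hY_rv : DegreeCorrelation.IsRegularlyVarying P (fun ω => (Y 0 ω : ℝ)) γ)
    (c : ℝ) (hc : 0 < c)
    (h_tail : Tendsto (fun t : ℝ => P.real {ω | t < (Y 0 ω : ℝ)} / P.real {ω | t < (X 0 ω : ℝ)})
      atTop (𝓝 c)) :
    ∃ (Ω' : Type) (_ : MeasurableSpace Ω') (Q : Measure Ω') (_ : IsProbabilityMeasure Q)
      (SX SY : Ω' → ℝ) (b : ℕ → ℝ),
      -- the limits are independent, positive, `γ / 2`-stable random variables
      Measurable SX ∧ Measurable SY ∧ IndepFun SX SY Q ∧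
      (∀ᵐ ω ∂Q, 0 < SX ω) ∧ (∀ᵐ ω ∂Q, 0 < SY ω) ∧
      DegreeCorrelation.IsStableLaw (γ / 2) (Q.map SX) ∧
      DegreeCorrelation.IsStableLaw (γ / 2) (Q.map SY) ∧
      -- they are the limits of the sums of squares, with one common normalization
      (∀ n, 0 < b n) ∧
      TendstoInDistribution (fun n ω => (∑ i ∈ Finset.range n, (X i ω : ℝ) ^ 2) / b n)
        atTop SX (fun _ => P) Q ∧
      TendstoInDistribution (fun n ω => (∑ i ∈ Finset.range n, (Y i ω : ℝ) ^ 2) / b n)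
        atTop SY (fun _ => P) Q ∧
      -- for every `a > 0` the In/Out coefficient is well defined with probability tending to one
      -- and converges in distribution
      (∀ a : ℝ, 0 < a →
        Tendsto (fun n : ℕ => P.real {ω |
            0 < DegreeCorrelation.sigmaSource
              (DegreeCorrelation.bridgeCollection a (fun i => X i ω) (fun i => Y i ω) n) .inDeg ∧
            0 < DegreeCorrelation.sigmaTarget
              (DegreeCorrelation.bridgeCollection a (fun i => X i ω) (fun i => Y i ω) n) .outDeg})
          atTop (𝓝 1) ∧
        TendstoInDistribution
          (fun n ω => DegreeCorrelation.pearson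
            (DegreeCorrelation.bridgeCollection a (fun i => X i ω) (fun i => Y i ω) n)
            .inDeg .outDeg)
          atTop
          (fun ω => (SX ω + a * SY ω) / (√(SX ω + SY ω) * √(SX ω + a ^ 2 * SY ω)))
          (fun _ => P) Q) ∧
      -- for `a ≠ 1` the limit is non-degenerate, with values in `(2 √a / (1 + a), 1)`
      (∀ a : ℝ, 0 < a → a ≠ 1 →
        (∀ x : ℝ, ¬ ∀ᵐ ω ∂Q,
          (SX ω + a * SY ω) / (√(SX ω + SY ω) * √(SX ω + a ^ 2 * SY ω)) = x) ∧
        ∀ᵐ ω ∂Q, (SX ω + a * SY ω) / (√(SX ω + SY ω) * √(SX ω + a ^ 2 * SY ω))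
          ∈ Set.Ioo (2 * √a / (1 + a)) 1) ∧
      -- for every `ε ∈ (0, 1)`, two explicit choices of `a` put the limit in `(ε, 1)`
      (∀ ε : ℝ, 0 < ε → ε < 1 → ∀ a : ℝ,
        (a = (2 - ε ^ 2 + 2 * √(1 - ε ^ 2)) / ε ^ 2 ∨
          a = (2 - ε ^ 2 - 2 * √(1 - ε ^ 2)) / ε ^ 2) →
        0 < a ∧ a ≠ 1 ∧ 2 * √a / (1 + a) = ε ∧
        ∀ᵐ ω ∂Q, (SX ω + a * SY ω) / (√(SX ω + SY ω) * √(SX ω + a ^ 2 * SY ω))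
          ∈ Set.Ioo ε 1) := by
  have hF := hX_rv.isRegularTail
  have hG := hY_rv.isRegularTail
  obtain ⟨B, hBpos, hBtop, hBF⟩ := hF.exists_normalizing hγ_pos
  -- Comparability of the tails lets the normalization of `X` serve for `Y`; `c` enters only as a
  -- scale factor in the limit.
  have hBG : ∀ x : ℝ, 0 < x → Tendsto (fun n : ℕ => n * P.real {ω | B n * x < (Y 0 ω : ℝ)}) atTop
      (𝓝 (c * x ^ (-γ))) := by
    intro x hx
    have h1 := (h_tail.comp (hBtop.atTop_mul_const hx)).mul (hBF x hx)
    refine h1.congr fun n => ?_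
    have := (hF.pos (B n * x)).ne'
    simp only [Function.comp] at this ⊢
    field_simp
  have hB1 : ∀ᶠ n : ℕ in atTop, n * P.real {ω | B n < (X 0 ω : ℝ)} ≤ 2 := by
    have := (hBF 1 one_pos).eventually_le_const (show (1 : ℝ) ^ (-γ) < 2 by simp)
    simpa using this
  have hX_indep : iIndepFun X P :=
    iIndepFun.precomp (f := Sum.elim X Y) Sum.inl_injective h_indep
  have hY_indep : iIndepFun Y P :=
    iIndepFun.precomp (f := Sum.elim X Y) Sum.inr_injective h_indep
  have hb : ∀ n, 0 < B n ^ 2 := fun n => pow_pos (hBpos n) 2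
  have hα : 0 < γ / 2 := by positivity
  have hα1 : γ / 2 < 1 := by linarith
  obtain ⟨μ, hμ, hμlim⟩ := DegreeCorrelation.exists_isPositiveStable_sqSum hX_meas hX_indep hX_ident
    hγ_pos hγ_lt hF hBpos hBtop one_pos (by simpa using hBF)
    (fun n => DegreeCorrelation.measurable_sqSum hX_meas n _)
  obtain ⟨ν, hν, hνlim⟩ := DegreeCorrelation.exists_isPositiveStable_sqSum hY_meas hY_indep hY_ident
    hγ_pos hγ_lt hG hBpos hBtop hc hBG (fun n => DegreeCorrelation.measurable_sqSum hY_meas n _)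
  have hjoint := DegreeCorrelation.tendstoInDistribution_prodMk_of_indepFun
    (fun n => DegreeCorrelation.measurable_sqSum hX_meas n _)
    (fun n => DegreeCorrelation.measurable_sqSum hY_meas n _)
    (fun n => DegreeCorrelation.indepFun_sqSum hX_meas hY_meas h_indep n _) hμlim hνlim
  have herr := DegreeCorrelation.tendstoInMeasure_errSum hX_meas hY_meas
    (fun i => h_indep.indepFun (i := Sum.inl i) (j := Sum.inr i) Sum.inl_ne_inr) hX_ident hY_ident
    hγ_pos hγ_lt hF hG hBpos fun r hr => hF.tendsto_div_rpow hγ_pos hBtop hB1 hr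
  have hatom := hν.measure_singleton hα hα1
  -- The limits are the coordinates on the product space, fixed together with `B n ^ 2` before `a`
  -- is introduced.
  refine ⟨ℝ × ℝ, inferInstance, (μ : Measure ℝ).prod (ν : Measure ℝ), inferInstance, Prod.fst,
    Prod.snd, fun n => B n ^ 2, measurable_fst, measurable_snd,
    indepFun_prod measurable_id measurable_id, DegreeCorrelation.ae_fst_pos hμ.ae_pos,
    DegreeCorrelation.ae_snd_pos hν.ae_pos, ?_, ?_, hb, hjoint.continuous_comp continuous_fst,
    hjoint.continuous_comp continuous_snd, fun a ha =>
      ⟨DegreeCorrelation.tendsto_measureReal_sigma_pos hX_meas hY_meas hb hjoint herr hμ.ae_pos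
        hν.ae_pos ha,
      DegreeCorrelation.tendstoInDistribution_pearson hX_meas hY_meas hb hjoint herr hμ.ae_pos
        hν.ae_pos ha⟩, fun a ha ha1 =>
      ⟨DegreeCorrelation.not_ae_limitCorr_eq hμ.ae_pos hν.ae_pos hatom ha ha1,
      DegreeCorrelation.ae_limitCorr_mem_Ioo hμ.ae_pos hν.ae_pos hatom ha ha1⟩, ?_⟩
  · rw [Measure.map_fst_prod, measure_univ, one_smul]
    exact hμ.isStableLaw hα hα1
  · rw [Measure.map_snd_prod, measure_univ, one_smul]
    exact hν.isStableLaw hα hα1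
  · intro ε hε hε1 a ha
    obtain ⟨ha0, ha1, hae⟩ := DegreeCorrelation.eq_of_eq_parameter hε hε1 ha
    refine ⟨ha0, ha1, hae, ?_⟩
    have := DegreeCorrelation.ae_limitCorr_mem_Ioo hμ.ae_pos hν.ae_pos hatom ha0 ha1
    rwa [hae] at this
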